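/- Let $M$ be a compact, connected three-manifold, possibly with boundary, with universal covering $\phi\colon\widetilde M\to M$; let $\pi_1(M)$ act on $\widetilde M$ by deck transformations, and let $\Delta_M$ be the set of connected components of $\partial\widetilde M=\phi^{-1}(\partial M)$. Let $\mathcal T$ be an ideal triangulation of $M$, that is, a finite collection of tetrahedra with affine pairings of their faces (each face being paired with exactly one other face), together with a homeomorphism from the realisation $|\mathcal T|$ minus its vertices to $M\setminus\partial M$. Let $\widetilde{\mathcal T}$ be the induced triangulation of $\widetilde M$; its ideal vertices are naturally in bijection with $\Delta_M$. Let $\rho\colon\pi_1(M)\to\mathrm{PSL}(2,\mathbb C)$ be a representation. An *anchoring* of $\rho$ is a function $L\colon\Delta_M\to\partial_\infty\mathbb H^3=\mathbb{CP}^1$ with $L(\gamma c)=\rho(\gamma)L(c)$ for all $\gamma\in\pi_1(M)$ and $c\in\Delta_M$. The triangulation $\mathcal T$ is *$L$-essential* if no edge of $\widetilde{\mathcal T}$ has the same label $L$ at both of its ends. A *solution of Thurston's gluing equations* on $\mathcal T$ is a choice $Z$ of a shape $z_t\in\mathbb C\setminus\{0,1\}$ for every tetrahedron $t$ of $\mathcal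 T$ (the cross-ratio of its four ordered ideal vertices, normalised so that the cross-ratio of $0,\infty,1,z$ is $z$) such that, for every edge of $\mathcal T$, the product of the shape parameters of the tetrahedra around this edge is $1$. Here the parameter of a tetrahedron at an edge $ab$, in passing from its face $abc$ to its face $abd$, is the cross-ratio of its vertices taken in the order $a,b,c,d$. The *holonomy* $\rho_Z\colon\pi_1(M)\to\mathrm{PSL}(2,\mathbb C)$ of a solution $Z$ is well defined up to conjugation: place the vertices of one tetrahedron $\widetilde t_0$ of $\widetilde{\mathcal T}$ at distinct points of $\mathbb{CP}^1$ with the cross-ratio prescribed by $Z$, and develop from there across faces, giving every tetrahedron its shape; then $\rho_Z(\gamma)$ is the element that carries the placement of $\widetilde t_0$ to the developed placement of $\gamma\widetilde t_0$. Then the following are equivalent: 1. there is an anchoring $L$ of $\rho$ such that $\mathcal T$ is $L$-essential; 2. there is a solution $Z$ of Thurston's gluing equations on $\mathcal T$ such that $\rho_Z$ is conjugate to $\rho$. -/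

import Mathlib

open Set Filter Topology

noncomputable section

/-! ### Three-manifolds with boundary -/

/-- `M` is a (topological) three-manifold whose boundary is `B`: every point lies in a chart to the
closed half space `{x ∈ ℝ³ | 0 ≤ x 0}` which carries the points of `B`, and no others, into the
boundary plane `{x 0 = 0}`.  (Points off `B` thus have charts into the open half space; by
invariance of domain the set `B` is determined by `M`.) -/
def IsThreeManifoldWithBoundary (M : Type*) [TopologicalSpace M] (B : Set M) : Prop :=
  ∀ x : M, ∃ e : OpenPartialHomeomorph M (EuclideanHalfSpace 3),
    x ∈ e.source ∧ ∀ y ∈ e.source, (y ∈ B ↔ (e y).1 0 = 0)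

/-! ### The sphere at infinity and cross-ratios -/

/-- `∂_∞ ℍ³ = ℂP¹`, with Mathlib's action of `PSL(2, ℂ)`. -/
abbrev CP1 : Type := Projectivization ℂ (Fin 2 → ℂ)

/-- `PSL(2, ℂ)`. -/
abbrev PSL2C : Type := Matrix.ProjectiveSpecialLinearGroup (Fin 2) ℂ

/-- The determinant of two vectors; for `(x, 1)` and `(y, 1)` it is `x - y`. -/
def det2 (v w : Fin 2 → ℂ) : ℂ := v 0 * w 1 - v 1 * w 0

/-- The cross-ratio of four distinct points, normalised so that that of `0, ∞, 1, z` is `z`.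
It does not depend on the representatives. -/
def crossRatio (a b c d : CP1) : ℂ :=
  (det2 d.rep a.rep * det2 c.rep b.rep) / (det2 c.rep a.rep * det2 d.rep b.rep)

/-- The four points are the ideal vertices, in order, of an ideal tetrahedron of shape `z`. -/
def HasShape (q : Fin 4 → CP1) (z : ℂ) : Prop :=
  Function.Injective q ∧ crossRatio (q 0) (q 1) (q 2) (q 3) = z

/-- The standard ideal tetrahedron of shape `z`, with ideal vertices `0, ∞, 1, z`. -/
def stdPlacement (z : ℂ) : Fin 4 → CP1 :=
  ![Projectivization.mk ℂ ![0, 1] (by simp),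
    Projectivization.mk ℂ ![1, 0] (by simp),
    Projectivization.mk ℂ ![1, 1] (by simp),
    Projectivization.mk ℂ ![z, 1] (by simp)]

/-- The shape parameter of a tetrahedron of shape `z` at its edge from vertex `σ 0` to
vertex `σ 1`, read from the face containing `σ 2` towards the face containing `σ 3`.
It is one of `z, 1 / z, 1 - z, 1 / (1 - z), (z - 1) / z, z / (z - 1)`. -/
def edgeParam (z : ℂ) (σ : Equiv.Perm (Fin 4)) : ℂ :=
  crossRatio (stdPlacement z (σ 0)) (stdPlacement z (σ 1))
    (stdPlacement z (σ 2)) (stdPlacement z (σ 3))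

/-! ### Triangulations -/

/-- A triangulation with model tetrahedra indexed by `T`.  Face `i` of a model tetrahedron is the
one opposite to vertex `i`.  Face `i` of `t` is paired with face `perm t i i` of `adj t i`, by the
affine map that sends vertex `j ≠ i` to vertex `perm t i j`.  Pairings come together with their
inverses, and no face is paired with itself.  No compatibility with orientations is asked for. -/
structure Triangulation (T : Type*) where
  adj : T → Fin 4 → T
  perm : T → Fin 4 → Equiv.Perm (Fin 4)
  adj_adj : ∀ t i, adj (adj t i) (perm t i i) = t
  perm_perm : ∀ t i, perm (adj t i) (perm t i i) = (perm t i)⁻¹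
  not_self : ∀ t i, ¬ (adj t i = t ∧ perm t i i = i)

/-- The standard tetrahedron. -/
abbrev ModelTet : Type := stdSimplex ℝ (Fin 4)

/-- The standard tetrahedron with its four vertices removed. -/
abbrev PuncturedTet : Type := {x : ModelTet // ∀ i, x.1 i ≠ 1}

/-- Vertex `i` of the standard tetrahedron. -/
def modelVertex (i : Fin 4) : ModelTet := ⟨Pi.single i 1, single_mem_stdSimplex ℝ i⟩

namespace Triangulation

variable {T : Type*} (K : Triangulation T)

/-- A point of face `i` of a model tetrahedron, and its image under the face pairing. -/
def Glued (a b : Σ _ : T, ModelTet) : Prop :=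
  ∃ i, a.2.1 i = 0 ∧ b.1 = K.adj a.1 i ∧ ∀ j, b.2.1 (K.perm a.1 i j) = a.2.1 j

/-- The realisation: the disjoint union of the model tetrahedra, modulo the face pairings, with
the quotient topology. -/
abbrev Realization : Type _ := Quot K.Glued

/-- The image in the realisation of a point of the model tetrahedron `t`. -/
def point (t : T) (x : ModelTet) : K.Realization := Quot.mk _ ⟨t, x⟩

/-- The vertices of the realisation. -/
def vertices : Set K.Realization := {v | ∃ t i, v = K.point t (modelVertex i)}

theorem point_not_mem_vertices (t : T) (x : PuncturedTet) : K.point t x.1 ∉ K.vertices := by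
  have hinv : ∀ a b : Σ _ : T, ModelTet, K.Glued a b →
      (∃ i, a.2.1 i = 1) = (∃ i, b.2.1 i = 1) := by
    rintro a b ⟨i, -, -, h⟩
    refine propext ⟨fun ⟨j, hj⟩ => ⟨_, (h j).trans hj⟩, fun ⟨j, hj⟩ => ?_⟩
    refine ⟨(K.perm a.1 i).symm j, ?_⟩
    rw [← h, Equiv.apply_symm_apply, hj]
  rintro ⟨t', i, h⟩
  have h1 := congrArg (Quot.lift (fun a : Σ _ : T, ModelTet => ∃ i, a.2.1 i = 1) hinv) h
  have h2 : (∃ j, x.1.1 j = 1) = (∃ j, (modelVertex i).1 j = 1) := h1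
  have h3 : ∃ j, (modelVertex i).1 j = 1 := ⟨i, by simp [modelVertex]⟩
  rw [← h2] at h3
  obtain ⟨j, hj⟩ := h3
  exact x.2 j hj

/-! ### Thurston's gluing equations -/

/-- A tetrahedron `t` with an ordering `σ` of its vertices is seen as the corner of `t` along the
edge from `σ 0` to `σ 1`, between its face containing `σ 2` and its face containing `σ 3`.
`rot` leaves this corner through the latter face into the next corner around the same edge of the
triangulation. -/
def rot (a : T × Equiv.Perm (Fin 4)) : T × Equiv.Perm (Fin 4) :=
  (K.adj a.1 (a.2 2), K.perm a.1 (a.2 2) * a.2 * Equiv.swap 2 3)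

/-- `Z` solves Thurston's gluing equations: every shape is in `ℂ ∖ {0, 1}`, and once around each
edge the product of the shape parameters at that edge is one. -/
def IsGluingSolution (Z : T → ℂ) : Prop :=
  (∀ t, Z t ≠ 0 ∧ Z t ≠ 1) ∧
    ∀ a : T × Equiv.Perm (Fin 4),
      ∏ k ∈ Finset.range (Function.minimalPeriod K.rot a),
        edgeParam (Z (K.rot^[k] a).1) (K.rot^[k] a).2 = 1

end Triangulation

/-- An ideal triangulation, with tetrahedra indexed by `T`, of the manifold `M` with boundary `B`:
the realisation minus all of its vertices is identified with `M ∖ B`. -/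
structure IdealTriangulation (T : Type*) {M : Type*} [TopologicalSpace M] (B : Set M)
    extends Triangulation T where
  homeo : {v : toTriangulation.Realization // v ∉ toTriangulation.vertices} ≃ₜ {x : M // x ∉ B}

/-- The characteristic map of a model tetrahedron, minus its vertices, to `M`. -/
def IdealTriangulation.charMap {T M : Type*} [TopologicalSpace M] {B : Set M}
    (K : IdealTriangulation T B) (t : T) (x : PuncturedTet) : M :=
  (K.homeo ⟨K.point t x.1, K.point_not_mem_vertices t x⟩).1

section UniversalCover

/-! ### The universal covering `p : M' → M` -/

variable {M M' : Type*} [TopologicalSpace M] [TopologicalSpace M']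

/-- The group of deck transformations. -/
def Deck (p : M' → M) : Subgroup (M' ≃ₜ M') where
  carrier := {f | ∀ x, p (f x) = p x}
  mul_mem' := fun {f g} hf hg x => (hf (g x)).trans (hg x)
  one_mem' := fun _ => rfl
  inv_mem' := fun {f} hf x => by
    have := hf (f⁻¹ x)
    rw [← this]
    exact congrArg p (f.apply_symm_apply x)

/-- The standard isomorphism from the deck group of the universal covering to `π₁(M)`: the deck
transformation `f` goes to the class of the loop that lifts to a path from `f x₀` to `x₀`.
(The path has this direction because in Mathlib the product `α * β` in the fundamental group is
`β` followed by `α`.) -/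
def deckToPi1 [SimplyConnectedSpace M'] {p : M' → M} (hp : IsCoveringMap p) (x₀ : M') :
    Deck p →* FundamentalGroup M (p x₀) where
  toFun f := FundamentalGroup.fromPath (Path.Homotopic.Quotient.mk
    (((PathConnectedSpace.somePath (f.1 x₀) x₀).map hp.continuous).cast (f.2 x₀).symm rfl))
  map_one' := by
    refine Quotient.sound ?_
    exact Path.Homotopic.map
      (SimplyConnectedSpace.paths_homotopic (PathConnectedSpace.somePath x₀ x₀) (Path.refl x₀))
      ⟨p, hp.continuous⟩
  map_mul' f g := by
    have h1 := Path.Homotopic.pathCast (Path.Homotopic.map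
      (SimplyConnectedSpace.paths_homotopic (PathConnectedSpace.somePath ((f * g).1 x₀) x₀)
        (((PathConnectedSpace.somePath (g.1 x₀) x₀).map f.1.continuous).trans
          (PathConnectedSpace.somePath (f.1 x₀) x₀)))
      ⟨p, hp.continuous⟩) ((f * g).2 x₀).symm rfl
    refine (Path.Homotopic.Quotient.eq.2 h1).trans ?_
    change _ = Path.Homotopic.Quotient.trans _ _
    rw [← Path.Homotopic.Quotient.mk_trans]
    refine congrArg Path.Homotopic.Quotient.mk ?_
    ext t
    change p ((Path.trans _ _) t) = (Path.trans _ _) t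
    rw [Path.trans_apply, Path.trans_apply]
    split_ifs
    · exact f.2 _
    · rfl

/-- `Δ_M`, the set of components of the boundary of the universal cover. -/
abbrev BoundaryComponents (p : M' → M) (B : Set M) : Type _ := ConnectedComponents (p ⁻¹' B)

/-- A deck transformation, restricted to the boundary of the universal cover. -/
def Deck.onBoundary {p : M' → M} (B : Set M) (f : Deck p) (b : p ⁻¹' B) : p ⁻¹' B :=
  ⟨f.1 b.1, by
    have h : p b.1 ∈ B := b.2
    change p (f.1 b.1) ∈ B
    rwa [f.2]⟩

/-- `L : Δ_M → ∂_∞ ℍ³` is an anchoring of `ρ`: it satisfies `L (γ c) = ρ(γ) (L c)` for all `γ` in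
`π₁(M)` and `c` in `Δ_M`. -/
def IsAnchoring [SimplyConnectedSpace M'] {p : M' → M} (hp : IsCoveringMap p) (x₀ : M')
    (B : Set M) (ρ : FundamentalGroup M (p x₀) →* PSL2C) (L : BoundaryComponents p B → CP1) :
    Prop :=
  ∀ (f : Deck p) (b : p ⁻¹' B),
    L (ConnectedComponents.mk (Deck.onBoundary B f b)) =
      ρ (deckToPi1 hp x₀ f) • L (ConnectedComponents.mk b)

variable {T : Type*} {B : Set M}

/-- A tetrahedron of the induced triangulation of the universal cover: a lift of (the
characteristic map of) a tetrahedron of the triangulation. -/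
structure LiftedTet (K : IdealTriangulation T B) (p : M' → M) where
  tet : T
  map : C(PuncturedTet, M')
  lifts : ∀ x, p (map x) = K.charMap tet x

namespace LiftedTet

variable {K : IdealTriangulation T B} {p : M' → M}

/-- The action of a deck transformation on the lifted tetrahedra. -/
def translate (f : Deck p) (τ : LiftedTet K p) : LiftedTet K p where
  tet := τ.tet
  map := ⟨fun x => f.1 (τ.map x), f.1.continuous.comp τ.map.continuous⟩
  lifts := fun x => (f.2 _).trans (τ.lifts x)

/-- `τ'` is the neighbour of `τ` across face `i` of `τ` in the universal cover. -/
def IsNeighbour (τ : LiftedTet K p) (i : Fin 4) (τ' : LiftedTet K p) : Prop :=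
  τ'.tet = K.adj τ.tet i ∧
    ∀ x y : PuncturedTet, x.1.1 i = 0 → (∀ j, y.1.1 (K.perm τ.tet i j) = x.1.1 j) →
      τ'.map y = τ.map x

/-- The natural bijection between the ideal vertices of the lifted triangulation and `Δ_M`, as a
relation: vertex `i` of `τ` is at the component `c` of the boundary of the universal cover.  That
is, for every open neighbourhood `U` of the boundary of `M`, all points of `τ` close enough to its
vertex `i` lie in the component of `p⁻¹(U)` that contains `c`. -/
def VertexAt (τ : LiftedTet K p) (i : Fin 4) (c : BoundaryComponents p B) : Prop :=
  ∀ b : p ⁻¹' B, ConnectedComponents.mk b = c → ∀ U : Set M, IsOpen U → B ⊆ U →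
    ∀ᶠ x in comap (Subtype.val : PuncturedTet → ModelTet) (𝓝 (modelVertex i)),
      τ.map x ∈ connectedComponentIn (p ⁻¹' U) b.1

/-- Developing the shapes `Z` along a gallery of lifted tetrahedra, starting with the vertices of
`τ₀` placed at `q₀`: at each step one crosses a face into a neighbour, keeps the three vertices of
that face where they are, and places the fourth so that the neighbour gets its shape.
`Develops Z τ₀ q₀ τ q` says that some gallery from `τ₀` to `τ` develops the vertices of `τ`
to `q`. -/
inductive Develops (Z : T → ℂ) (τ₀ : LiftedTet K p) (q₀ : Fin 4 → CP1) :
    LiftedTet K p → (Fin 4 → CP1) → Prop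
  | refl : Develops Z τ₀ q₀ τ₀ q₀
  | step {τ τ' : LiftedTet K p} {q q' : Fin 4 → CP1} (i : Fin 4) :
      Develops Z τ₀ q₀ τ q → τ.IsNeighbour i τ' →
      (∀ j, j ≠ i → q' (K.perm τ.tet i j) = q j) → HasShape q' (Z τ'.tet) →
      Develops Z τ₀ q₀ τ' q'

end LiftedTet

/-- The triangulation is `L`-essential: no edge of the lifted triangulation has the same label at
both of its ends. -/
def IsEssential (K : IdealTriangulation T B) (p : M' → M) (L : BoundaryComponents p B → CP1) :
    Prop :=
  ∀ (τ : LiftedTet K p) (i j : Fin 4), i ≠ j → ∀ u v : BoundaryComponents p B,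
    τ.VertexAt i u → τ.VertexAt j v → L u ≠ L v

/-- `ρ'` is a holonomy representation `ρ_Z` of `Z`: for some initial lifted tetrahedron `τ₀`,
placed at `q₀` with its shape, and for every `γ` in `π₁(M)`, developing `Z` from `τ₀` along
galleries to `γ τ₀` places the vertices of `γ τ₀` at `ρ'(γ) q₀` (and nowhere else).
When `Z` solves the gluing equations the result does not depend on the gallery, as the universal
cover is simply connected; another choice of `τ₀` and `q₀` conjugates `ρ'`. -/
def IsHolonomy [SimplyConnectedSpace M'] (K : IdealTriangulation T B) {p : M' → M}
    (hp : IsCoveringMap p) (x₀ : M') (Z : T → ℂ) (ρ' : FundamentalGroup M (p x₀) →* PSL2C) :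
    Prop :=
  ∃ (τ₀ : LiftedTet K p) (q₀ : Fin 4 → CP1), HasShape q₀ (Z τ₀.tet) ∧
    ∀ (f : Deck p) (q : Fin 4 → CP1),
      LiftedTet.Develops Z τ₀ q₀ (τ₀.translate f) q ↔ q = fun i => ρ' (deckToPi1 hp x₀ f) • q₀ i

end UniversalCover

end

/-! An anchoring is a labelling of the ideal vertices of the lifted triangulation by points of the
sphere, equivariant under `ρ`; a developing map restricts to the same kind of object. The proof
passes between the two.

Given an essential anchoring, the four labels of each lifted tetrahedron are distinct and have a
cross-ratio. Lifts of one tetrahedron differ by a deck transformation, which changes the labels by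
an element of `PSL2C`, so the cross-ratio is a shape downstairs. Each parameter at an edge is a
quotient of two values of `edgeCoord`, and the product around the edge telescopes
(`exists_rot_iterate`). The walk around the edge closes up in the universal cover because it fixes
the edge pointwise. The labels form a development of these shapes, so the holonomy is `ρ` itself.

Conversely, the holonomy condition at the identity says that galleries closing up at the initial
tetrahedron bring its vertices back. Three vertices and the shape determine the fourth
(`eq_of_eq_off`), so development is independent of the gallery (`Develops.unique`). It therefore
defines labels of ideal vertices, equivariant by `Develops.translate` and distinct along edges
because placed tetrahedra are nondegenerate. A conjugation of the holonomy is absorbed by moving all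
labels.

The topological work is to match ideal vertices (`Cusp`) with boundary components. The corners at
one ideal vertex, with coordinate above 1/2, form a connected open set, and different ideal vertices
give disjoint sets. Together with boundary points they give disjoint regions covering a
neighbourhood of the boundary, and a boundary component is at a vertex exactly when it lies in the
region of this vertex (`vertexAt_iff`). That a region holds only one component needs a neighbourhood
of `B` in `M` whose preimage keeps two components apart (`separates_boundary`); compactness of `B`
is essential there. -/

noncomputable section

/-! ### Cross-ratios -/

theorem det2_smul_smul (r s : ℂ) (v w : Fin 2 → ℂ) : det2 (r • v) (s • w) = r * s * det2 v w := by
  simp only [det2, Pi.smul_apply, smul_eq_mul]; ring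

theorem det2_swap (v w : Fin 2 → ℂ) : det2 w v = - det2 v w := by
  simp only [det2]; ring

theorem det2_eq_zero_iff {v w : Fin 2 → ℂ} (hv : v ≠ 0) (hw : w ≠ 0) :
    det2 v w = 0 ↔ Projectivization.mk ℂ v hv = Projectivization.mk ℂ w hw := by
  rw [Projectivization.mk_eq_mk_iff']
  constructor
  · intro h
    have h' : v 0 * w 1 = v 1 * w 0 := sub_eq_zero.1 h
    by_cases h0 : w 0 = 0
    · have h1 : w 1 ≠ 0 := fun h1 => hw (by ext i; fin_cases i <;> simp [h0, h1])
      refine ⟨v 1 / w 1, ?_⟩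
      ext i
      fin_cases i
      · have : v 0 = 0 := by simpa [h0, h1] using h'
        simp [h0, this]
      · simp [h1]
    · refine ⟨v 0 / w 0, ?_⟩
      ext i
      fin_cases i
      · simp [h0]
      · simp only [Pi.smul_apply, smul_eq_mul, Fin.mk_one]
        field_simp
        linear_combination h'
  · rintro ⟨r, rfl⟩
    simp only [det2, Pi.smul_apply, smul_eq_mul]; ring

theorem det2_rep_eq_zero_iff {a b : CP1} : det2 a.rep b.rep = 0 ↔ a = b := by
  rw [det2_eq_zero_iff a.rep_nonzero b.rep_nonzero, a.mk_rep, b.mk_rep]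

theorem det2_rep_ne_zero {a b : CP1} (h : a ≠ b) : det2 a.rep b.rep ≠ 0 :=
  fun h' => h (det2_rep_eq_zero_iff.1 h')

theorem Projectivization.exists_rep_mk_eq_smul {v : Fin 2 → ℂ} (hv : v ≠ 0) :
    ∃ r : ℂ, r ≠ 0 ∧ (Projectivization.mk ℂ v hv).rep = r • v := by
  obtain ⟨u, hu⟩ := Projectivization.exists_smul_eq_mk_rep ℂ v hv
  exact ⟨u, u.ne_zero, hu.symm⟩

theorem crossRatio_mk {a b c d : Fin 2 → ℂ} (ha : a ≠ 0) (hb : b ≠ 0) (hc : c ≠ 0) (hd : d ≠ 0) :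
    crossRatio (.mk ℂ a ha) (.mk ℂ b hb) (.mk ℂ c hc) (.mk ℂ d hd) =
      (det2 d a * det2 c b) / (det2 c a * det2 d b) := by
  obtain ⟨r, hr, har⟩ := Projectivization.exists_rep_mk_eq_smul ha
  obtain ⟨s, hs, hbs⟩ := Projectivization.exists_rep_mk_eq_smul hb
  obtain ⟨t, ht, hct⟩ := Projectivization.exists_rep_mk_eq_smul hc
  obtain ⟨u, hu, hdu⟩ := Projectivization.exists_rep_mk_eq_smul hd
  rw [crossRatio, har, hbs, hct, hdu]
  simp only [det2_smul_smul]
  rw [show u * r * det2 d a * (t * s * det2 c b) = (r * s * t * u) * (det2 d a * det2 c b) by ring,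
    show t * r * det2 c a * (u * s * det2 d b) = (r * s * t * u) * (det2 c a * det2 d b) by ring]
  exact mul_div_mul_left _ _ (by simp [hr, hs, ht, hu])

theorem det2_mulVec (g : Matrix (Fin 2) (Fin 2) ℂ) (v w : Fin 2 → ℂ) :
    det2 (g.mulVec v) (g.mulVec w) = g.det * det2 v w := by
  simp only [det2, Matrix.mulVec, dotProduct, Fin.sum_univ_two, Matrix.det_fin_two]; ring

theorem crossRatio_smul (g : PSL2C) (a b c d : CP1) :
    crossRatio (g • a) (g • b) (g • c) (g • d) = crossRatio a b c d := by
  induction g using QuotientGroup.induction_on with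
  | H g =>
    induction a using Projectivization.ind with | _ a ha =>
    induction b using Projectivization.ind with | _ b hb =>
    induction c using Projectivization.ind with | _ c hc =>
    induction d using Projectivization.ind with | _ d hd =>
    have key : ∀ (v : Fin 2 → ℂ) (hv : v ≠ 0), ∃ h : g.1.mulVec v ≠ 0,
        ((g : PSL2C) • (Projectivization.mk ℂ v hv) : CP1) =
          Projectivization.mk ℂ (g.1.mulVec v) h := fun v hv => ⟨_, rfl⟩
    obtain ⟨ha', ea⟩ := key a ha
    obtain ⟨hb', eb⟩ := key b hb
    obtain ⟨hc', ec⟩ := key c hc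
    obtain ⟨hd', ed⟩ := key d hd
    rw [ea, eb, ec, ed, crossRatio_mk, crossRatio_mk]
    simp only [det2_mulVec, g.2, one_mul]

theorem HasShape.smul {q : Fin 4 → CP1} {z : ℂ} (h : HasShape q z) (g : PSL2C) :
    HasShape (fun i => g • q i) z :=
  ⟨(MulAction.injective g).comp h.1, (crossRatio_smul g _ _ _ _).trans h.2⟩

section Symmetries

variable {a b c d : CP1}

theorem crossRatio_swap_pairs (a b c d : CP1) : crossRatio b a d c = crossRatio a b c d := by
  simp only [crossRatio]
  congr 1 <;> ring

theorem crossRatio_swap_halves (a b c d : CP1) : crossRatio c d a b = crossRatio a b c d := by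
  simp only [crossRatio]
  rw [det2_swap d.rep b.rep, det2_swap c.rep a.rep, det2_swap d.rep a.rep, det2_swap c.rep b.rep]
  congr 1 <;> ring

theorem crossRatio_swap_last (a b c d : CP1) : crossRatio a b d c = (crossRatio a b c d)⁻¹ := by
  simp only [crossRatio, inv_div]

theorem crossRatio_swap_first (a b c d : CP1) : crossRatio b a c d = (crossRatio a b c d)⁻¹ := by
  rw [← crossRatio_swap_pairs, crossRatio_swap_last]

theorem crossRatio_ne_zero (hca : c ≠ a) (hdb : d ≠ b) (hda : d ≠ a) (hcb : c ≠ b) :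
    crossRatio a b c d ≠ 0 :=
  div_ne_zero (mul_ne_zero (det2_rep_ne_zero hda) (det2_rep_ne_zero hcb))
    (mul_ne_zero (det2_rep_ne_zero hca) (det2_rep_ne_zero hdb))

/-- The Plücker relation among the six determinants of four vectors in the plane. It keeps the
cross-ratio away from 1 and yields the effect of exchanging the two middle points. -/
theorem one_sub_crossRatio (hca : c ≠ a) (hdb : d ≠ b) :
    1 - crossRatio a b c d =
      (det2 a.rep b.rep * det2 c.rep d.rep) / (det2 c.rep a.rep * det2 d.rep b.rep) := by
  have h1 := det2_rep_ne_zero hca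
  have h2 := det2_rep_ne_zero hdb
  rw [crossRatio, eq_div_iff (mul_ne_zero h1 h2), sub_mul, div_mul_cancel₀ _ (mul_ne_zero h1 h2)]
  simp only [det2]; ring

theorem crossRatio_ne_one (hca : c ≠ a) (hdb : d ≠ b) (hab : a ≠ b) (hcd : c ≠ d) :
    crossRatio a b c d ≠ 1 := by
  intro h
  have h1 := one_sub_crossRatio hca hdb
  rw [h, sub_self] at h1
  exact div_ne_zero (mul_ne_zero (det2_rep_ne_zero hab) (det2_rep_ne_zero hcd))
    (mul_ne_zero (det2_rep_ne_zero hca) (det2_rep_ne_zero hdb)) h1.symm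

theorem crossRatio_swap_middle (hca : c ≠ a) (hdb : d ≠ b) (hab : a ≠ b) (hcd : c ≠ d) :
    crossRatio a c b d = crossRatio a b c d * (crossRatio a b c d - 1)⁻¹ := by
  have h1 := det2_rep_ne_zero hca
  have h2 := det2_rep_ne_zero hdb
  have h3 := det2_rep_ne_zero hab
  have h4 := det2_rep_ne_zero hcd
  rw [← neg_sub 1 (crossRatio a b c d), one_sub_crossRatio hca hdb, crossRatio, crossRatio,
    det2_swap a.rep b.rep, det2_swap c.rep d.rep, det2_swap c.rep b.rep]
  field_simp

end Symmetries

theorem Fin.four_injective {α : Type*} {q : Fin 4 → α} (h01 : q 0 ≠ q 1) (h02 : q 0 ≠ q 2)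
    (h03 : q 0 ≠ q 3) (h12 : q 1 ≠ q 2) (h13 : q 1 ≠ q 3) (h23 : q 2 ≠ q 3) :
    Function.Injective q := by
  intro i j h
  fin_cases i <;> fin_cases j <;> first | rfl | exact absurd h ‹_› | exact absurd h.symm ‹_›

/-- The cross-ratio of a reordered quadruple depends only on that of the quadruple. -/
theorem crossRatio_perm_congr (σ : Equiv.Perm (Fin 4)) : ∀ q q' : Fin 4 → CP1,
    Function.Injective q → Function.Injective q' →
    crossRatio (q 0) (q 1) (q 2) (q 3) = crossRatio (q' 0) (q' 1) (q' 2) (q' 3) →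
    crossRatio (q (σ 0)) (q (σ 1)) (q (σ 2)) (q (σ 3)) =
      crossRatio (q' (σ 0)) (q' (σ 1)) (q' (σ 2)) (q' (σ 3)) := by
  -- Adjacent transpositions generate the symmetric group, and each acts on the cross-ratio `z` by a
  -- formula in `z` alone: `z⁻¹`, `z / (z - 1)` and `z⁻¹`.
  have hσ : σ ∈ Submonoid.closure
      (Set.range fun i : Fin 3 => Equiv.swap i.castSucc i.succ) := by
    rw [Equiv.Perm.mclosure_swap_castSucc_succ]; trivial
  induction hσ using Submonoid.closure_induction with
  | one => exact fun q q' _ _ h => h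
  | mul σ τ _ _ hσ hτ =>
    intro q q' hq hq' h
    exact hτ (q ∘ σ) (q' ∘ σ) (hq.comp σ.injective) (hq'.comp σ.injective) (hσ q q' hq hq' h)
  | mem σ h =>
    obtain ⟨i, rfl⟩ := h
    intro q q' hq hq' h
    fin_cases i
    · change crossRatio (q 1) (q 0) (q 2) (q 3) = crossRatio (q' 1) (q' 0) (q' 2) (q' 3)
      rw [crossRatio_swap_first (q 0), h, crossRatio_swap_first (q' 0)]
    · change crossRatio (q 0) (q 2) (q 1) (q 3) = crossRatio (q' 0) (q' 2) (q' 1) (q' 3)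
      rw [crossRatio_swap_middle (b := q 1) (hq.ne (by decide)) (hq.ne (by decide)) (hq.ne (by decide))
        (hq.ne (by decide)), h, crossRatio_swap_middle (b := q' 1) (hq'.ne (by decide)) (hq'.ne (by decide))
        (hq'.ne (by decide)) (hq'.ne (by decide))]
    · change crossRatio (q 0) (q 1) (q 3) (q 2) = crossRatio (q' 0) (q' 1) (q' 3) (q' 2)
      rw [crossRatio_swap_last (q 0) (q 1) (q 2), h, crossRatio_swap_last (q' 0) (q' 1) (q' 2)]

theorem hasShape_stdPlacement {z : ℂ} (h0 : z ≠ 0) (h1 : z ≠ 1) : HasShape (stdPlacement z) z := by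
  constructor
  · have key : ∀ {v w : Fin 2 → ℂ} (hv : v ≠ 0) (hw : w ≠ 0), det2 v w ≠ 0 →
        Projectivization.mk ℂ v hv ≠ Projectivization.mk ℂ w hw :=
      fun hv hw h h' => h ((det2_eq_zero_iff hv hw).2 h')
    apply Fin.four_injective <;> apply key <;>
      simp [det2, h0, sub_eq_zero, Ne.symm h1]
  · change crossRatio (.mk ℂ _ _) (.mk ℂ _ _) (.mk ℂ _ _) (.mk ℂ _ _) = z
    rw [crossRatio_mk]
    simp [det2]

theorem HasShape.ne_zero {q : Fin 4 → CP1} {z : ℂ} (h : HasShape q z) : z ≠ 0 := by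
  rw [← h.2]
  apply crossRatio_ne_zero <;> exact h.1.ne (by decide)

theorem HasShape.ne_one {q : Fin 4 → CP1} {z : ℂ} (h : HasShape q z) : z ≠ 1 := by
  rw [← h.2]
  apply crossRatio_ne_one <;> exact h.1.ne (by decide)

theorem HasShape.edgeParam_eq {q : Fin 4 → CP1} {z : ℂ} (h : HasShape q z)
    (σ : Equiv.Perm (Fin 4)) :
    edgeParam z σ = crossRatio (q (σ 0)) (q (σ 1)) (q (σ 2)) (q (σ 3)) := by
  have h' := hasShape_stdPlacement h.ne_zero h.ne_one
  exact crossRatio_perm_congr σ _ _ h'.1 h.1 (h'.2.trans h.2.symm)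

/-- The function whose quotients are the cross-ratios at the edge `a b`. -/
def edgeCoord (a b x : CP1) : ℂ := det2 x.rep a.rep / det2 x.rep b.rep

theorem edgeCoord_ne_zero {a b x : CP1} (ha : x ≠ a) (hb : x ≠ b) : edgeCoord a b x ≠ 0 :=
  div_ne_zero (det2_rep_ne_zero ha) (det2_rep_ne_zero hb)

theorem crossRatio_eq_edgeCoord_div (a b c d : CP1) :
    crossRatio a b c d = edgeCoord a b d / edgeCoord a b c := by
  rw [crossRatio, edgeCoord, edgeCoord, div_div_div_eq, mul_comm (det2 d.rep b.rep)]

/-! ### The fourth vertex -/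

theorem crossRatio_last_injective {a b c d d' : CP1} (hab : a ≠ b) (hca : c ≠ a) (hcb : c ≠ b)
    (hdb : d ≠ b) (hdb' : d' ≠ b)
    (h : crossRatio a b c d = crossRatio a b c d') : d = d' := by
  have h1 := det2_rep_ne_zero hdb
  have h2 := det2_rep_ne_zero hdb'
  have h3 := edgeCoord_ne_zero hca hcb
  rw [crossRatio_eq_edgeCoord_div, crossRatio_eq_edgeCoord_div, div_left_inj' h3, edgeCoord,
    edgeCoord, div_eq_div_iff h1 h2] at h
  rw [← det2_rep_eq_zero_iff]
  -- Up to sign, the cross-multiplied difference of the two edge coordinates is this product, again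
  -- by the Plücker relation.
  have h5 : det2 a.rep b.rep * det2 d.rep d'.rep = 0 := by
    simp only [det2] at h ⊢
    linear_combination h
  exact (mul_eq_zero.1 h5).resolve_left (det2_rep_ne_zero hab)

theorem exists_crossRatio_eq {a b c : CP1} (hab : a ≠ b) (hca : c ≠ a) (hcb : c ≠ b) {z : ℂ}
    (h0 : z ≠ 0) (h1 : z ≠ 1) :
    ∃ d : CP1, d ≠ a ∧ d ≠ b ∧ d ≠ c ∧ crossRatio a b c d = z := by
  have e1 := det2_rep_ne_zero hab
  have e2 := det2_rep_ne_zero hca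
  have e3 := det2_rep_ne_zero hcb
  -- With `z = 1` this is a multiple of `c` expanded in the basis `a`, `b`; scaling the
  -- `b`-coordinate by `z` scales the edge coordinate by `z`. The values `z = 0` and `z = 1` would
  -- give `a` and `c`.
  set w : Fin 2 → ℂ := det2 c.rep b.rep • a.rep - (z * det2 c.rep a.rep) • b.rep with hw
  have ea : det2 w a.rep = z * det2 c.rep a.rep * det2 a.rep b.rep := by
    simp only [hw, det2, Pi.sub_apply, Pi.smul_apply, smul_eq_mul]; ring
  have eb : det2 w b.rep = det2 c.rep b.rep * det2 a.rep b.rep := by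
    simp only [hw, det2, Pi.sub_apply, Pi.smul_apply, smul_eq_mul]; ring
  have ec : det2 w c.rep = (z - 1) * (det2 c.rep a.rep * det2 c.rep b.rep) := by
    simp only [hw, det2, Pi.sub_apply, Pi.smul_apply, smul_eq_mul]; ring
  have hw0 : w ≠ 0 := by
    intro h
    rw [h] at eb
    have : (0 : ℂ) = det2 c.rep b.rep * det2 a.rep b.rep := by simpa [det2] using eb
    exact mul_ne_zero e3 e1 this.symm
  have key : ∀ x : CP1, det2 w x.rep ≠ 0 → Projectivization.mk ℂ w hw0 ≠ x := by
    intro x hx h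
    apply hx
    rw [det2_eq_zero_iff hw0 x.rep_nonzero, h, x.mk_rep]
  refine ⟨.mk ℂ w hw0, key a ?_, key b ?_, key c ?_, ?_⟩
  · rw [ea]; exact mul_ne_zero (mul_ne_zero h0 e2) e1
  · rw [eb]; exact mul_ne_zero e3 e1
  · rw [ec]; exact mul_ne_zero (sub_ne_zero.2 h1) (mul_ne_zero e2 e3)
  · conv_lhs => rw [← a.mk_rep, ← b.mk_rep, ← c.mk_rep]
    rw [crossRatio_mk, ea, eb]
    field_simp

/-- The double transpositions, used to bring any vertex of a tetrahedron to the last place. -/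
theorem exists_perm_three_crossRatio (k : Fin 4) : ∃ σ : Equiv.Perm (Fin 4), σ 3 = k ∧
    ∀ q : Fin 4 → CP1, crossRatio (q (σ 0)) (q (σ 1)) (q (σ 2)) (q (σ 3)) =
      crossRatio (q 0) (q 1) (q 2) (q 3) := by
  fin_cases k
  · refine ⟨Equiv.swap 0 3 * Equiv.swap 1 2, by decide, fun q => ?_⟩
    change crossRatio (q 3) (q 2) (q 1) (q 0) = _
    rw [← crossRatio_swap_halves, crossRatio_swap_pairs]
  · refine ⟨Equiv.swap 0 2 * Equiv.swap 1 3, by decide, fun q => ?_⟩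
    exact crossRatio_swap_halves _ _ _ _
  · refine ⟨Equiv.swap 0 1 * Equiv.swap 2 3, by decide, fun q => ?_⟩
    exact crossRatio_swap_pairs _ _ _ _
  · exact ⟨1, rfl, fun q => rfl⟩

/-- A double transposition moves the unknown vertex to the last slot without changing the
cross-ratio, which is injective in that slot. This rigidity makes each developing step unique. -/
theorem HasShape.eq_of_eq_off {q q' : Fin 4 → CP1} {z : ℂ} (h : HasShape q z) (h' : HasShape q' z)
    (k : Fin 4) (hk : ∀ j, j ≠ k → q j = q' j) : q = q' := by
  obtain ⟨σ, hσ, hcr⟩ := exists_perm_three_crossRatio k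
  have e : ∀ j : Fin 4, j ≠ 3 → q (σ j) = q' (σ j) := fun j hj =>
    hk _ fun hjk => hj (σ.injective (hjk.trans hσ.symm))
  have h1 := (hcr q).trans (h.2.trans (h'.2.symm.trans (hcr q').symm))
  rw [← e 0 (by decide), ← e 1 (by decide), ← e 2 (by decide)] at h1
  have hi := h.1.comp σ.injective
  have hi' := h'.1.comp σ.injective
  have h2 := crossRatio_last_injective (hi.ne (by decide : (0 : Fin 4) ≠ 1))
    (hi.ne (by decide : (2 : Fin 4) ≠ 0)) (hi.ne (by decide : (2 : Fin 4) ≠ 1))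
    (hi.ne (by decide : (3 : Fin 4) ≠ 1))
    (by rw [Function.comp_apply, e 1 (by decide)]; exact hi'.ne (by decide : (3 : Fin 4) ≠ 1)) h1
  ext1 j
  by_cases hj : j = k
  · rw [hj, ← hσ]; exact h2
  · exact hk j hj

theorem exists_hasShape_of_eq_off {z : ℂ} (h0 : z ≠ 0) (h1 : z ≠ 1) (k : Fin 4) {q : Fin 4 → CP1}
    (hq : ∀ i j, i ≠ k → j ≠ k → q i = q j → i = j) :
    ∃ q', HasShape q' z ∧ ∀ j, j ≠ k → q' j = q j := by
  obtain ⟨σ, hσ, hcr⟩ := exists_perm_three_crossRatio k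
  have hne : ∀ i j : Fin 4, i ≠ 3 → j ≠ 3 → i ≠ j → q (σ i) ≠ q (σ j) := by
    intro i j hi hj hij h
    refine hij (σ.injective (hq _ _ ?_ ?_ h)) <;> rw [← hσ] <;> exact σ.injective.ne ‹_›
  obtain ⟨d, hda, hdb, hdc, hd⟩ := exists_crossRatio_eq
    (hne 0 1 (by decide) (by decide) (by decide)) (hne 2 0 (by decide) (by decide) (by decide))
    (hne 2 1 (by decide) (by decide) (by decide)) h0 h1
  have e : ∀ j : Fin 4, j ≠ 3 → Function.update q k d (σ j) = q (σ j) := fun j hj =>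
    Function.update_of_ne (fun hjk => hj (σ.injective (hjk.trans hσ.symm))) _ _
  have e3 : Function.update q k d (σ 3) = d := by rw [hσ, Function.update_self]
  refine ⟨Function.update q k d, ⟨?_, ?_⟩, fun j hj => Function.update_of_ne hj _ _⟩
  · have : Function.Injective (Function.update q k d ∘ σ) := by
      apply Fin.four_injective <;> simp only [Function.comp_apply, e3, e 0 (by decide),
        e 1 (by decide), e 2 (by decide)]
      · exact hne 0 1 (by decide) (by decide) (by decide)
      · exact hne 0 2 (by decide) (by decide) (by decide)
      · exact hda.symm
      · exact hne 1 2 (by decide) (by decide) (by decide)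
      · exact hdb.symm
      · exact hdc.symm
    exact (Function.Injective.of_comp_iff' _ σ.bijective).1 this
  · rw [← hcr, e3, e 0 (by decide), e 1 (by decide), e 2 (by decide), hd]

/-! ### The standard tetrahedron without its vertices -/

namespace PuncturedTet

theorem nonneg (x : PuncturedTet) (i : Fin 4) : 0 ≤ x.1.1 i := x.1.2.1 i

theorem sum_eq_one (x : PuncturedTet) : ∑ i, x.1.1 i = 1 := x.1.2.2

theorem lt_one (x : PuncturedTet) (i : Fin 4) : x.1.1 i < 1 :=
  lt_of_le_of_ne (mem_Icc_of_mem_stdSimplex x.1.2 i).2 (x.2 i)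

theorem add_le_one (x : PuncturedTet) {i j : Fin 4} (h : i ≠ j) : x.1.1 i + x.1.1 j ≤ 1 := by
  refine le_trans ?_ x.sum_eq_one.le
  rw [← Finset.sum_pair h]
  exact Finset.sum_le_sum_of_subset_of_nonneg (Finset.subset_univ _) fun k _ _ => x.nonneg k

/-- This is why 1/2 serves as the threshold for corners: those at different vertices are disjoint.
-/
theorem eq_of_half_lt (x : PuncturedTet) {i j : Fin 4} (hi : 1 / 2 < x.1.1 i)
    (hj : 1 / 2 < x.1.1 j) : i = j := by
  by_contra h
  linarith [x.add_le_one h]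

theorem ext {x y : PuncturedTet} (h : ∀ i, x.1.1 i = y.1.1 i) : x = y :=
  Subtype.ext (Subtype.ext (funext h))

theorem continuous_coord (i : Fin 4) : Continuous fun x : PuncturedTet => x.1.1 i :=
  (continuous_apply i).comp (continuous_subtype_val.comp continuous_subtype_val)

/-- Constructor from barycentric coordinates. -/
def ofCoords (v : Fin 4 → ℝ) (h : v ∈ {v | v ∈ stdSimplex ℝ (Fin 4) ∧ ∀ i, v i ≠ 1}) :
    PuncturedTet :=
  ⟨⟨v, h.1⟩, h.2⟩

theorem lt_one_of_mem {v : Fin 4 → ℝ}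
    (h : v ∈ {v | v ∈ stdSimplex ℝ (Fin 4) ∧ ∀ i, v i ≠ 1}) (i : Fin 4) : v i < 1 :=
  (ofCoords v h).lt_one i

/-- The removed points are extreme: on the simplex, `v i ≠ 1` means `v i < 1`. Convexity makes
characteristic maps liftable and keeps corners and faces connected. -/
theorem convex_coords : Convex ℝ {v | v ∈ stdSimplex ℝ (Fin 4) ∧ ∀ i, v i ≠ 1} := by
  intro v hv w hw a b ha hb hab
  refine ⟨convex_stdSimplex ℝ _ hv.1 hw.1 ha hb hab, fun i => ne_of_lt ?_⟩
  have h1 := lt_one_of_mem hv i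
  have h2 := lt_one_of_mem hw i
  simp only [Pi.add_apply, Pi.smul_apply, smul_eq_mul]
  rcases ha.eq_or_lt with rfl | ha
  · have : b = 1 := by linarith
    subst this; linarith
  · nlinarith

/-- The punctured tetrahedron as a convex set in `ℝ⁴`. -/
def homeoCoords : {v | v ∈ stdSimplex ℝ (Fin 4) ∧ ∀ i, v i ≠ 1} ≃ₜ PuncturedTet where
  toFun v := ofCoords v.1 v.2
  invFun x := ⟨x.1.1, x.1.2, x.2⟩
  left_inv _ := rfl
  right_inv _ := rfl
  continuous_toFun := Continuous.subtype_mk (Continuous.subtype_mk continuous_subtype_val _) _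
  continuous_invFun :=
    Continuous.subtype_mk (continuous_subtype_val.comp continuous_subtype_val) _

/-- The point of the edge `i j` at distance `s` from `i`. -/
def edgePoint {i j : Fin 4} (h : i ≠ j) (s : ℝ) (h0 : 0 < s) (h1 : s < 1) : PuncturedTet :=
  ofCoords (fun k => if k = i then 1 - s else if k = j then s else 0) <| by
    refine ⟨⟨fun k => ?_, ?_⟩, fun k => ne_of_lt ?_⟩
    · dsimp only
      split_ifs <;> linarith
    · rw [Finset.sum_ite, Finset.sum_ite]
      simp [Finset.filter_eq', h.symm, Finset.filter_ne']
    · dsimp only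
      split_ifs <;> linarith

theorem edgePoint_left {i j : Fin 4} (h : i ≠ j) (s : ℝ) (h0 : 0 < s) (h1 : s < 1) :
    (edgePoint h s h0 h1).1.1 i = 1 - s := if_pos rfl

theorem edgePoint_other {i j k : Fin 4} (h : i ≠ j) (s : ℝ) (h0 : 0 < s) (h1 : s < 1)
    (hi : k ≠ i) (hj : k ≠ j) : (edgePoint h s h0 h1).1.1 k = 0 :=
  (if_neg hi).trans (if_neg hj)

/-- Renaming the vertices. -/
def reindex (σ : Equiv.Perm (Fin 4)) (x : PuncturedTet) : PuncturedTet :=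
  ofCoords (fun k => x.1.1 (σ.symm k))
    ⟨⟨fun _ => x.nonneg _, (Equiv.sum_comp σ.symm x.1.1).trans x.sum_eq_one⟩, fun _ => x.2 _⟩

theorem reindex_apply (σ : Equiv.Perm (Fin 4)) (x : PuncturedTet) (j : Fin 4) :
    (x.reindex σ).1.1 (σ j) = x.1.1 j :=
  congrArg x.1.1 (σ.symm_apply_apply j)

theorem eq_reindex {σ : Equiv.Perm (Fin 4)} {x y : PuncturedTet}
    (h : ∀ j, y.1.1 (σ j) = x.1.1 j) : y = x.reindex σ := by
  refine ext fun k => ?_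
  obtain ⟨j, rfl⟩ := σ.surjective k
  rw [h, reindex_apply]

theorem exists_ne_ne (i k : Fin 4) : ∃ j, j ≠ i ∧ j ≠ k := by revert i k; decide

/-- A face contains points near each of its vertices. -/
theorem exists_lt_and_eq_zero {i k : Fin 4} (h : i ≠ k) {δ : ℝ} (hδ : δ < 1) :
    ∃ x : PuncturedTet, δ < x.1.1 i ∧ x.1.1 k = 0 := by
  obtain ⟨j, hji, hjk⟩ := exists_ne_ne i k
  obtain ⟨s, hs0, hs1⟩ := exists_between (lt_min one_pos (sub_pos.2 hδ))
  rw [lt_min_iff] at hs1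
  refine ⟨edgePoint hji.symm s hs0 hs1.1, ?_, edgePoint_other _ _ _ _ h.symm hjk.symm⟩
  rw [edgePoint_left]; linarith

theorem exists_corner (i : Fin 4) {δ : ℝ} (hδ : δ < 1) : ∃ x : PuncturedTet, δ < x.1.1 i := by
  obtain ⟨j, hj, -⟩ := exists_ne_ne i i
  obtain ⟨x, hx, -⟩ := exists_lt_and_eq_zero hj.symm hδ
  exact ⟨x, hx⟩

instance : Nonempty PuncturedTet := ⟨(exists_corner 0 one_half_lt_one).choose⟩

instance : SimplyConnectedSpace PuncturedTet := by
  have : ContractibleSpace {v | v ∈ stdSimplex ℝ (Fin 4) ∧ ∀ i, v i ≠ 1} :=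
    convex_coords.contractibleSpace 
      ⟨_, (homeoCoords.symm (Classical.arbitrary _)).2⟩
  have : ContractibleSpace PuncturedTet := homeoCoords.symm.contractibleSpace
  infer_instance

instance : LocallyPathConnectedSpace PuncturedTet := by
  have := convex_coords.locallyPathConnectedSpace
  exact homeoCoords.symm.isOpenEmbedding.locallyPathConnectedSpace

theorem isOpen_corner (i : Fin 4) (δ : ℝ) : IsOpen {x : PuncturedTet | δ < x.1.1 i} :=
  isOpen_lt continuous_const (continuous_coord i)

theorem isPreconnected_corner (i : Fin 4) (δ : ℝ) :
    IsPreconnected {x : PuncturedTet | δ < x.1.1 i} := by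
  have h1 : Convex ℝ ({v | v ∈ stdSimplex ℝ (Fin 4) ∧ ∀ i, v i ≠ 1} ∩ {v | δ < v i}) :=
    convex_coords.inter ((convex_Ioi δ).is_linear_preimage
      (LinearMap.isLinear (LinearMap.proj (R := ℝ) (φ := fun _ : Fin 4 => ℝ) i)))
  have h2 := h1.isPreconnected
  rw [← Subtype.image_preimage_coe, Topology.IsInducing.subtypeVal.isPreconnected_image] at h2
  have h3 := h2.image homeoCoords homeoCoords.continuous.continuousOn
  convert! h3 using 1
  ext x
  constructor
  · intro hx
    exact ⟨homeoCoords.symm x, hx, homeoCoords.apply_symm_apply x⟩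
  · rintro ⟨v, hv, rfl⟩
    exact hv

theorem tendsto_coord (i : Fin 4) : Tendsto (fun x : PuncturedTet => x.1.1 i)
    (comap (Subtype.val : PuncturedTet → ModelTet) (𝓝 (modelVertex i))) (𝓝 1) := by
  have h : Tendsto (fun x : ModelTet => x.1 i) (𝓝 (modelVertex i)) (𝓝 ((modelVertex i).1 i)) :=
    ((continuous_apply i).comp continuous_subtype_val).tendsto _
  have h1 : (modelVertex i).1 i = 1 := by simp [modelVertex]
  rw [h1] at h
  exact h.comp tendsto_comap

theorem eventually_corner (i : Fin 4) {δ : ℝ} (hδ : δ < 1) :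
    ∀ᶠ x in comap (Subtype.val : PuncturedTet → ModelTet) (𝓝 (modelVertex i)), δ < x.1.1 i :=
  (tendsto_coord i).eventually (lt_mem_nhds hδ)

/-- The missing vertex is a limit of points of an edge, so "close enough to the vertex" in
`VertexAt` is never vacuous. -/
instance neBot_comap (i : Fin 4) :
    NeBot (comap (Subtype.val : PuncturedTet → ModelTet) (𝓝 (modelVertex i))) := by
  obtain ⟨j, hj, -⟩ := exists_ne_ne i i
  rw [comap_neBot_iff]
  intro t ht
  have hc : Continuous fun s : ℝ => fun k : Fin 4 =>
      if k = i then 1 - s else if k = j then s else 0 := by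
    refine continuous_pi fun k => ?_
    split_ifs <;> fun_prop
  rw [nhds_subtype, mem_comap] at ht
  obtain ⟨u, hu, hut⟩ := ht
  have h0 : (fun k : Fin 4 => if k = i then 1 - (0 : ℝ) else if k = j then 0 else 0) =
      (modelVertex i).1 := by
    ext k
    by_cases hk : k = i
    · subst hk; simp [modelVertex]
    · simp [modelVertex, hk]
  have h1 := hc.tendsto 0
  rw [h0] at h1
  have h2 : ∀ᶠ s : ℝ in 𝓝[>] 0, _ := nhdsWithin_le_nhds (h1 hu)
  obtain ⟨s, hs, hs0, hs1⟩ := (h2.and (Ioo_mem_nhdsGT (one_pos : (0 : ℝ) < 1))).exists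
  exact ⟨edgePoint hj.symm s hs0 hs1, hut hs⟩

end PuncturedTet

/-! ### Covering maps -/

section Covering

variable {M M' : Type*} [TopologicalSpace M] [TopologicalSpace M'] {p : M' → M}

/-- One neighbourhood serves all sheets at once. Sections over it move connectedness up and openness
both ways between `M` and the cover. -/
theorem IsCoveringMap.exists_section (hp : IsCoveringMap p) (m : M) :
    ∃ O, IsOpen O ∧ m ∈ O ∧ ∀ y, p y ∈ O → ∃ s : M → M', ContinuousOn s O ∧
      (∀ v ∈ O, p (s v) = v) ∧ s (p y) = y ∧ ∀ V ⊆ O, IsOpen V → IsOpen (s '' V) := by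
  classical
  obtain ⟨-, O, hm, hO, -, H, hH⟩ := hp m
  refine ⟨O, hO, hm, fun y hy => ?_⟩
  let s : M → M' := fun v => if h : v ∈ O then (H.symm (⟨v, h⟩, (H ⟨y, hy⟩).2)).1 else y
  have hs : ∀ v (h : v ∈ O), s v = (H.symm (⟨v, h⟩, (H ⟨y, hy⟩).2)).1 := fun v h => dif_pos h
  have hc : ContinuousOn s O := by
    rw [continuousOn_iff_continuous_domRestrict]
    have : O.domRestrict s = fun v : O => (H.symm (v, (H ⟨y, hy⟩).2)).1 := by
      ext v; exact hs v.1 v.2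
    rw [this]
    fun_prop
  have hps : ∀ v ∈ O, p (s v) = v := by
    intro v hv
    rw [hs v hv, ← hH, H.apply_symm_apply]
  refine ⟨s, hc, hps, ?_, ?_⟩
  · rw [hs _ hy]
    have : ((⟨p y, hy⟩ : O), (H ⟨y, hy⟩).2) = H ⟨y, hy⟩ := 
      Prod.ext (Subtype.ext (hH ⟨y, hy⟩).symm) rfl
    rw [this, H.symm_apply_apply]
  · intro V hVO hV
    have h1 : IsLocalHomeomorph (p ∘ O.domRestrict s) := by
      have : p ∘ O.domRestrict s = Subtype.val := by ext v; exact hps v.1 v.2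
      rw [this]
      exact hO.isOpenEmbedding_subtypeVal.isLocalHomeomorph
    have h2 := IsLocalHomeomorph.of_comp h1 hp.isLocalHomeomorph
      (continuousOn_iff_continuous_domRestrict.1 hc)
    have h3 := h2.isOpenMap _ (hV.preimage (continuous_subtype_val (p := (· ∈ O))))
    convert! h3 using 1
    ext z
    constructor
    · rintro ⟨v, hv, rfl⟩
      exact ⟨⟨v, hVO hv⟩, hv, rfl⟩
    · rintro ⟨v, hv, rfl⟩
      exact ⟨v.1, hv, rfl⟩

/-- Fibres of a covering map may be empty a priori. A section through one point reaches all of an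
evenly covered set, so the open range is also closed. -/
theorem IsCoveringMap.surjective [PreconnectedSpace M] [Nonempty M'] (hp : IsCoveringMap p) :
    Function.Surjective p := by
  rw [← range_eq_univ]
  refine IsClopen.eq_univ ⟨⟨isOpen_iff_mem_nhds.2 fun m hm => ?_⟩, hp.isOpenMap.isOpen_range⟩
    (range_nonempty p)
  obtain ⟨O, hO, hmO, h⟩ := hp.exists_section m
  filter_upwards [hO.mem_nhds hmO]
  rintro _ hv ⟨y, rfl⟩
  obtain ⟨s, -, hs, -⟩ := h y hv
  exact hm ⟨s m, hs m hmO⟩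

/-- Lift `p` through itself in both directions; each composite is a lift of `p` fixing a point,
hence the identity. -/
theorem IsCoveringMap.exists_deck [SimplyConnectedSpace M'] [LocallyPathConnectedSpace M']
    (hp : IsCoveringMap p) {y y' : M'} (h : p y' = p y) : ∃ f : Deck p, f.1 y = y' := by
  obtain ⟨F, ⟨hF, hpF⟩, -⟩ := hp.existsUnique_continuousMap_lifts ⟨p, hp.continuous⟩ y y' h
  obtain ⟨G, ⟨hG, hpG⟩, -⟩ := hp.existsUnique_continuousMap_lifts ⟨p, hp.continuous⟩ y' y h.symm
  have hF' : ∀ x, p (F x) = p x := congrFun hpF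
  have hG' : ∀ x, p (G x) = p x := congrFun hpG
  have h1 : G ∘ F = id := hp.eq_of_comp_eq (G.continuous.comp F.continuous) continuous_id
    (funext fun x => (hG' _).trans (hF' x)) y (by simp [hF, hG])
  have h2 : F ∘ G = id := hp.eq_of_comp_eq (F.continuous.comp G.continuous) continuous_id
    (funext fun x => (hF' _).trans (hG' x)) y' (by simp [hF, hG])
  exact ⟨⟨⟨⟨F, G, congrFun h1, congrFun h2⟩, F.continuous, G.continuous⟩, hF'⟩, hF⟩

end Covering

/-! ### Three-manifolds with boundary -/

namespace IsThreeManifoldWithBoundary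

variable {X : Type*} [TopologicalSpace X] {A : Set X}

theorem locallyPathConnectedSpace (hX : IsThreeManifoldWithBoundary X A) :
    LocallyPathConnectedSpace X := by
  let _ : ChartedSpace (EuclideanHalfSpace 3) X :=
    { atlas := univ
      chartAt := fun x => (hX x).choose
      mem_chart_source := fun x => (hX x).choose_spec.1
      chart_mem_atlas := fun _ => trivial }
  exact ChartedSpace.locallyPathConnectedSpace (EuclideanHalfSpace 3) X

theorem preimage {X' : Type*} [TopologicalSpace X'] {p : X' → X} (hp : IsLocalHomeomorph p)
    (hX : IsThreeManifoldWithBoundary X A) : IsThreeManifoldWithBoundary X' (p ⁻¹' A) := by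
  intro y
  obtain ⟨e, hy, rfl⟩ := hp y
  obtain ⟨e', hx, he'⟩ := hX (e y)
  refine ⟨e.trans e', ?_, ?_⟩
  · rw [OpenPartialHomeomorph.trans_source]
    exact ⟨hy, hx⟩
  · intro z hz
    rw [OpenPartialHomeomorph.trans_source] at hz
    exact he' (e z) hz.2

theorem isClosed_boundary (hX : IsThreeManifoldWithBoundary X A) : IsClosed A := by
  refine ⟨isOpen_iff_mem_nhds.2 fun x hx => ?_⟩
  obtain ⟨e, hxe, he⟩ := hX x
  have hc : Continuous fun w : EuclideanHalfSpace 3 => w.1 0 := by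
    have : Continuous fun w : EuclideanHalfSpace 3 => w.1 := continuous_subtype_val
    fun_prop
  have ho : IsOpen {w : EuclideanHalfSpace 3 | w.1 0 ≠ 0} := isOpen_ne_fun hc continuous_const
  filter_upwards [(e.isOpen_inter_preimage ho).mem_nhds ⟨hxe, fun h => hx ((he x hxe).2 h)⟩]
    with z hz hzA
  exact hz.2 ((he z hz.1).1 hzA)

theorem isPreconnected_preimage_halfSpace {C : Set (EuclideanSpace ℝ (Fin 3))} (hC : Convex ℝ C)
    (h0 : ∀ v ∈ C, 0 ≤ v 0) : IsPreconnected {w : EuclideanHalfSpace 3 | w.1 ∈ C} := by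
  have hi : IsInducing (fun w : EuclideanHalfSpace 3 => w.1) := IsInducing.subtypeVal
  rw [← hi.isPreconnected_image]
  convert! hC.isPreconnected using 1
  ext v
  constructor
  · rintro ⟨w, hw, rfl⟩
    exact hw
  · intro hv
    exact ⟨⟨v, h0 v hv⟩, hv, rfl⟩

/-- In a chart take a ball cut by the half space: the whole, its interior part and its boundary part
correspond to convex sets. The boundary part may be empty; the interior part is not, as the centre
can be pushed inwards. -/
theorem exists_preconnected_nhd (hX : IsThreeManifoldWithBoundary X A) (x : X) {U : Set X}
    (hU : U ∈ 𝓝 x) : ∃ V, IsOpen V ∧ x ∈ V ∧ V ⊆ U ∧ IsPreconnected V ∧ IsPreconnected (V \ A) ∧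
      (V \ A).Nonempty ∧ IsPreconnected (V ∩ A) := by
  obtain ⟨e, hxe, he⟩ := hX x
  have h1 : e.target ∩ e.symm ⁻¹' U ∈ 𝓝 (e x) :=
    inter_mem (e.open_target.mem_nhds (e.map_source hxe))
      ((e.continuousAt_symm (e.map_source hxe)) (by rwa [e.left_inv hxe]))
  have hi : IsInducing (fun w : EuclideanHalfSpace 3 => w.1) := IsInducing.subtypeVal
  rw [hi.nhds_eq_comap, (Metric.nhds_basis_ball.comap _).mem_iff] at h1
  obtain ⟨r, hr, hrU⟩ := h1
  set u := e x with hu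
  have hcoord : ∀ c : ℝ, Convex ℝ {v : EuclideanSpace ℝ (Fin 3) | c ≤ v 0} ∧
      Convex ℝ {v : EuclideanSpace ℝ (Fin 3) | c < v 0} ∧
      Convex ℝ {v : EuclideanSpace ℝ (Fin 3) | v 0 = c} := fun c => by
    have hl : IsLinearMap ℝ fun v : EuclideanSpace ℝ (Fin 3) => v 0 :=
      ⟨fun _ _ => rfl, fun _ _ => rfl⟩
    exact ⟨(convex_Ici c).is_linear_preimage hl, (convex_Ioi c).is_linear_preimage hl,
      (convex_singleton c).is_linear_preimage hl⟩
  have hball := convex_ball u.1 r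
  have key : ∀ Q : Set (EuclideanSpace ℝ (Fin 3)), Convex ℝ (Metric.ball u.1 r ∩ Q) →
      (∀ v ∈ Q, 0 ≤ v 0) →
      IsPreconnected (e.symm '' {w | w.1 ∈ Metric.ball u.1 r ∩ Q}) := by
    intro Q hQ hQ0
    refine (isPreconnected_preimage_halfSpace hQ fun v hv => hQ0 v hv.2).image _ ?_
    exact e.continuousOn_symm.mono fun w hw => (hrU hw.1).1
  set V := e.symm '' {w | w.1 ∈ Metric.ball u.1 r} with hV
  have hsub : {w : EuclideanHalfSpace 3 | w.1 ∈ Metric.ball u.1 r} ⊆ e.target :=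
    fun w hw => (hrU hw).1
  have e0 : V = e.symm '' {w | w.1 ∈ Metric.ball u.1 r ∩ {v | 0 ≤ v 0}} := by
    rw [hV]; congr 1; ext w; exact ⟨fun h => ⟨h, w.2⟩, fun h => h.1⟩
  have hmem : ∀ w : EuclideanHalfSpace 3, w.1 ∈ Metric.ball u.1 r →
      (e.symm w ∈ A ↔ w.1 0 = 0) := by
    intro w hw
    rw [he _ (e.map_target (hsub hw)), e.right_inv (hsub hw)]
  have e1 : V \ A = e.symm '' {w | w.1 ∈ Metric.ball u.1 r ∩ {v | 0 < v 0}} := by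
    ext z
    constructor
    · rintro ⟨⟨w, hw, rfl⟩, hz⟩
      exact ⟨w, ⟨hw, lt_of_le_of_ne w.2 fun h => hz ((hmem w hw).2 h.symm)⟩, rfl⟩
    · rintro ⟨w, hw, rfl⟩
      exact ⟨⟨w, hw.1, rfl⟩, fun h => (ne_of_gt hw.2) ((hmem w hw.1).1 h)⟩
  have e2 : V ∩ A = e.symm '' {w | w.1 ∈ Metric.ball u.1 r ∩ {v | v 0 = 0}} := by
    ext z
    constructor
    · rintro ⟨⟨w, hw, rfl⟩, hz⟩
      exact ⟨w, ⟨hw, (hmem w hw).1 hz⟩, rfl⟩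
    · rintro ⟨w, hw, rfl⟩
      exact ⟨⟨w, hw.1, rfl⟩, (hmem w hw.1).2 hw.2⟩
  refine ⟨V, ?_, ⟨u, Metric.mem_ball_self hr, e.left_inv hxe⟩, ?_, ?_, ?_, ?_, ?_⟩
  · exact e.symm.isOpen_image_of_subset_source (Metric.isOpen_ball.preimage hi.continuous) hsub
  · rintro _ ⟨w, hw, rfl⟩
    exact (hrU hw).2
  · rw [e0]
    exact key _ (hball.inter (hcoord 0).1) fun v hv => hv
  · rw [e1]
    exact key _ (hball.inter (hcoord 0).2.1) fun v hv => le_of_lt hv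
  · rw [e1]
    refine Nonempty.image _ ?_
    have hpos : 0 < (u.1 + EuclideanSpace.single 0 (r / 2) : EuclideanSpace ℝ (Fin 3)) 0 := by
      have := u.2
      simp only [PiLp.add_apply, PiLp.single_apply, if_true]
      linarith
    refine ⟨⟨u.1 + EuclideanSpace.single 0 (r / 2), hpos.le⟩, ?_, hpos⟩
    rw [mem_ball_iff_norm]
    simp [abs_of_pos hr, hr]
  · rw [e2]
    exact key _ (hball.inter (hcoord 0).2.2) fun v hv => ge_of_eq hv

theorem interior_boundary (hX : IsThreeManifoldWithBoundary X A) : interior A = ∅ := by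
  refine eq_empty_of_forall_notMem fun x hx => ?_
  obtain ⟨V, -, -, hVA, -, -, ⟨y, hyV, hyA⟩, -⟩ :=
    hX.exists_preconnected_nhd x (mem_interior_iff_mem_nhds.1 hx)
  exact hyA (hVA hyV)

/-- The interior of a connected manifold with boundary is connected. -/
theorem isPreconnected_compl [PreconnectedSpace X] (hX : IsThreeManifoldWithBoundary X A) :
    IsPreconnected Aᶜ := by
  rw [isPreconnected_iff_subset_of_disjoint]
  intro u v hu hv huv hdis
  -- A separation of the complement of `A` is fattened by `A` to one of `X`. The two fattened sets
  -- meet inside the interior of `A`, which is empty.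
  have hcover : (univ : Set X) ⊆ interior (u ∪ A) ∪ interior (v ∪ A) := by
    intro x _
    obtain ⟨V, hVo, hxV, -, -, hV, -, -⟩ := hX.exists_preconnected_nhd x univ_mem
    have h := isPreconnected_iff_subset_of_disjoint.1 hV u v hu hv
      (fun y hy => huv hy.2)
      (eq_empty_of_forall_notMem fun y hy => by
        have : y ∈ Aᶜ ∩ (u ∩ v) := ⟨hy.1.2, hy.2⟩
        rw [hdis] at this; exact this)
    have h' : ∀ w, V \ A ⊆ w → x ∈ interior (w ∪ A) := fun w hw =>
      mem_interior.2 ⟨V, fun y hy => (em (y ∈ A)).elim Or.inr fun hyA => Or.inl (hw ⟨hy, hyA⟩),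
        hVo, hxV⟩
    exact h.imp (h' u) (h' v)
  have hd : univ ∩ (interior (u ∪ A) ∩ interior (v ∪ A)) = ∅ := by
    rw [univ_inter, ← interior_inter, ← inter_union_distrib_right, ← subset_empty_iff,
      ← hX.interior_boundary]
    refine interior_mono ?_
    rintro y (hy | hy)
    · by_contra hyA
      have : y ∈ Aᶜ ∩ (u ∩ v) := ⟨hyA, hy⟩
      rw [hdis] at this; exact this
    · exact hy
  have h := isPreconnected_iff_subset_of_disjoint.1 (isPreconnected_univ (α := X)) _ _
    isOpen_interior isOpen_interior hcover hd
  refine h.imp (fun h x hx => ?_) (fun h x hx => ?_)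
  · exact (interior_subset (h (mem_univ x))).resolve_right hx
  · exact (interior_subset (h (mem_univ x))).resolve_right hx

end IsThreeManifoldWithBoundary

theorem PuncturedTet.isPreconnected_face (i : Fin 4) :
    IsPreconnected {x : PuncturedTet | x.1.1 i = 0} := by
  have h1 : Convex ℝ ({v | v ∈ stdSimplex ℝ (Fin 4) ∧ ∀ i, v i ≠ 1} ∩ {v | v i = 0}) :=
    convex_coords.inter ((convex_singleton (0 : ℝ)).is_linear_preimage
      (LinearMap.isLinear (LinearMap.proj (R := ℝ) (φ := fun _ : Fin 4 => ℝ) i)))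
  have h2 := h1.isPreconnected
  rw [← Subtype.image_preimage_coe, Topology.IsInducing.subtypeVal.isPreconnected_image] at h2
  have h3 := h2.image homeoCoords homeoCoords.continuous.continuousOn
  convert! h3 using 1
  ext x
  constructor
  · intro hx
    exact ⟨homeoCoords.symm x, hx, homeoCoords.apply_symm_apply x⟩
  · rintro ⟨v, hv, rfl⟩
    exact hv

theorem PuncturedTet.continuous_reindex (σ : Equiv.Perm (Fin 4)) :
    Continuous (PuncturedTet.reindex σ) :=
  Continuous.subtype_mk (Continuous.subtype_mk (continuous_pi fun _ => continuous_coord _) _) _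

theorem ModelTet.eq_modelVertex {x : ModelTet} {i : Fin 4} (h : x.1 i = 1) : x = modelVertex i := by
  refine Subtype.ext (funext fun j => ?_)
  by_cases hj : j = i
  · subst hj; simp [modelVertex, h]
  · have h1 : x.1 i + x.1 j ≤ 1 := by
      refine le_trans ?_ x.2.2.le
      rw [← Finset.sum_pair (Ne.symm hj)]
      exact Finset.sum_le_sum_of_subset_of_nonneg (Finset.subset_univ _) fun k _ _ => x.2.1 k
    have h2 := x.2.1 j
    simp only [modelVertex, Pi.single_apply, if_neg hj]
    linarith

namespace IdealTriangulation

variable {T M : Type*} [TopologicalSpace M] {B : Set M} (K : IdealTriangulation T B)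

theorem continuous_charMap (t : T) : Continuous (K.charMap t) := by
  refine continuous_subtype_val.comp (K.homeo.continuous.comp (Continuous.subtype_mk ?_ _))
  exact continuous_quot_mk.comp (continuous_sigmaMk.comp continuous_subtype_val)

theorem charMap_notMem (t : T) (x : PuncturedTet) : K.charMap t x ∉ B := (K.homeo _).2

theorem ne_one_of_point_notMem {t : T} {x : ModelTet} (h : K.point t x ∉ K.vertices) (i : Fin 4) :
    x.1 i ≠ 1 :=
  fun hi => h ⟨t, i, by rw [ModelTet.eq_modelVertex hi]⟩

theorem exists_charMap_eq {m : M} (hm : m ∉ B) : ∃ t x, K.charMap t x = m := by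
  obtain ⟨⟨v, hv⟩, hvm⟩ := K.homeo.surjective ⟨m, hm⟩
  induction v using Quot.ind with
  | mk a =>
    obtain ⟨t, x⟩ := a
    exact ⟨t, ⟨x, K.ne_one_of_point_notMem hv⟩, congrArg Subtype.val hvm⟩

theorem charMap_eq_iff {t t' : T} {x x' : PuncturedTet} :
    K.charMap t x = K.charMap t' x' ↔ K.point t x.1 = K.point t' x'.1 := by
  rw [charMap, charMap, Subtype.coe_inj, K.homeo.injective.eq_iff, Subtype.mk_eq_mk]

theorem charMap_adj {t : T} {i : Fin 4} {x : PuncturedTet} (hx : x.1.1 i = 0) :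
    K.charMap (K.adj t i) (x.reindex (K.perm t i)) = K.charMap t x :=
  K.charMap_eq_iff.2
    (Quot.sound (⟨i, hx, rfl, PuncturedTet.reindex_apply _ _⟩ : K.Glued ⟨t, x.1⟩ ⟨_, _⟩)).symm

end IdealTriangulation

/-! ### Lifted tetrahedra, neighbours and galleries -/

namespace LiftedTet

variable {T M M' : Type*} [TopologicalSpace M] [TopologicalSpace M'] {B : Set M}
  {K : IdealTriangulation T B} {p : M' → M}

theorem map_notMem (τ : LiftedTet K p) (x : PuncturedTet) : τ.map x ∉ p ⁻¹' B := by
  rw [mem_preimage, τ.lifts]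
  exact K.charMap_notMem _ _

theorem eq_of_map_eq (hp : IsCoveringMap p) {τ τ' : LiftedTet K p} (ht : τ.tet = τ'.tet)
    {x : PuncturedTet} (h : τ.map x = τ'.map x) : τ = τ' := by
  have h1 : (τ.map : PuncturedTet → M') = τ'.map :=
    hp.eq_of_comp_eq τ.map.continuous τ'.map.continuous
      (funext fun z => (τ.lifts z).trans (ht ▸ (τ'.lifts z).symm)) x h
  cases τ; cases τ'
  congr
  exact DFunLike.coe_injective h1

theorem exists_map_eq (hp : IsCoveringMap p) (t : T) (x : PuncturedTet) {y : M'}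
    (h : p y = K.charMap t x) : ∃ τ : LiftedTet K p, τ.tet = t ∧ τ.map x = y := by
  obtain ⟨F, ⟨hF, hpF⟩, -⟩ :=
    hp.existsUnique_continuousMap_lifts ⟨K.charMap t, K.continuous_charMap t⟩ x y h
  exact ⟨⟨t, F, congrFun hpF⟩, rfl, hF⟩

theorem exists_map_eq_of_notMem (hp : IsCoveringMap p) {y : M'} (hy : y ∉ p ⁻¹' B) :
    ∃ (τ : LiftedTet K p) (x : PuncturedTet), τ.map x = y := by
  obtain ⟨t, x, h⟩ := K.exists_charMap_eq (m := p y) hy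
  obtain ⟨τ, -, hτ⟩ := exists_map_eq hp t x h.symm
  exact ⟨τ, x, hτ⟩

theorem IsNeighbour.map_reindex {τ τ' : LiftedTet K p} {i : Fin 4} (h : τ.IsNeighbour i τ')
    {x : PuncturedTet} (hx : x.1.1 i = 0) :
    τ'.map (x.reindex (K.perm τ.tet i)) = τ.map x :=
  h.2 x _ hx (PuncturedTet.reindex_apply _ _)

/-- Both sides lift the same map on the connected face, so agreement at one point propagates. -/
theorem isNeighbour_of_map_reindex (hp : IsCoveringMap p) {τ τ' : LiftedTet K p} {i : Fin 4}
    (ht : τ'.tet = K.adj τ.tet i) {x : PuncturedTet} (hx : x.1.1 i = 0)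
    (h : τ'.map (x.reindex (K.perm τ.tet i)) = τ.map x) : τ.IsNeighbour i τ' := by
  refine ⟨ht, fun z w hz hw => ?_⟩
  rw [PuncturedTet.eq_reindex hw]
  refine hp.eqOn_of_comp_eqOn (PuncturedTet.isPreconnected_face i)
    (g₁ := fun z => τ'.map (z.reindex (K.perm τ.tet i))) (g₂ := τ.map) ?_
    τ.map.continuous.continuousOn (fun z (hz : z.1.1 i = 0) => ?_) hx h hz
  · exact (τ'.map.continuous.comp (PuncturedTet.continuous_reindex _)).continuousOn
  · simp only [Function.comp_apply]
    rw [τ'.lifts, τ.lifts, ht, K.charMap_adj hz]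

theorem exists_isNeighbour (hp : IsCoveringMap p) (τ : LiftedTet K p) (i : Fin 4) :
    ∃ τ', τ.IsNeighbour i τ' := by
  obtain ⟨j, hj, -⟩ := PuncturedTet.exists_ne_ne i i
  obtain ⟨x, -, hx⟩ := PuncturedTet.exists_lt_and_eq_zero hj one_half_lt_one
  obtain ⟨τ', ht, h⟩ := exists_map_eq hp (K.adj τ.tet i) (x.reindex (K.perm τ.tet i))
    ((τ.lifts x).trans (K.charMap_adj hx).symm)
  exact ⟨τ', isNeighbour_of_map_reindex hp ht hx h⟩

theorem IsNeighbour.perm_eq {τ τ' : LiftedTet K p} {i : Fin 4} (h : τ.IsNeighbour i τ') :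
    K.perm τ'.tet (K.perm τ.tet i i) = (K.perm τ.tet i)⁻¹ := by
  rw [h.1, K.perm_perm]

theorem IsNeighbour.symm {τ τ' : LiftedTet K p} {i : Fin 4} (h : τ.IsNeighbour i τ') :
    τ'.IsNeighbour (K.perm τ.tet i i) τ := by
  refine ⟨by rw [h.1, K.adj_adj], fun x y hx hy => ?_⟩
  rw [h.perm_eq] at hy
  have hy' : ∀ k, x.1.1 (K.perm τ.tet i k) = y.1.1 k := fun k => by
    rw [← hy]; exact congrArg y.1.1 ((K.perm τ.tet i).symm_apply_apply k)
  exact (h.2 y x (by rw [← hy', hx]) hy').symm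

theorem IsNeighbour.translate (f : Deck p) {τ τ' : LiftedTet K p} {i : Fin 4}
    (h : τ.IsNeighbour i τ') : (τ.translate f).IsNeighbour i (τ'.translate f) :=
  ⟨h.1, fun x y hx hy => congrArg f.1 (h.2 x y hx hy)⟩

/-- Two points of lifted tetrahedra with the same image are related by a chain of face pairings. -/
theorem of_map_eq (hp : IsCoveringMap p) {P : LiftedTet K p → PuncturedTet → Prop}
    (hP : ∀ τ τ' i x, x.1.1 i = 0 → τ.IsNeighbour i τ' → P τ x →
      P τ' (x.reindex (K.perm τ.tet i)))
    {τ τ' : LiftedTet K p} {x x' : PuncturedTet} (h : τ.map x = τ'.map x') (hx : P τ x) :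
    P τ' x' := by
  have hg : Relation.EqvGen K.Glued ⟨τ.tet, x.1⟩ ⟨τ'.tet, x'.1⟩ := by
    refine Quot.eqvGen_exact ?_
    change K.point _ _ = K.point _ _
    rw [← K.charMap_eq_iff, ← τ.lifts, ← τ'.lifts, h]
  -- The induction is on the generated equivalence relation. The lifts are quantified inside, since
  -- the transitive case inserts a new one, and the conclusion is an equivalence for the symmetric
  -- case.
  have key : ∀ a b : Σ _ : T, ModelTet, Relation.EqvGen K.Glued a b →
      ∀ (τ τ' : LiftedTet K p) (x x' : PuncturedTet), a = ⟨τ.tet, x.1⟩ → b = ⟨τ'.tet, x'.1⟩ →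
      τ.map x = τ'.map x' → (P τ x ↔ P τ' x') := by
    intro a b hab
    induction hab with
    | rel a b hab =>
      rintro τ τ' x x' rfl rfl h
      obtain ⟨i, hi, ht, hj⟩ := hab
      have hx' := PuncturedTet.eq_reindex hj
      have hn := isNeighbour_of_map_reindex hp ht hi (hx' ▸ h.symm)
      constructor
      · intro hx
        rw [hx']
        exact hP _ _ _ _ hi hn hx
      · intro hx
        have h1 := hP _ _ _ _ ((hj i).trans hi) hn.symm hx
        convert h1 using 1
        refine PuncturedTet.eq_reindex fun j => ?_
        rw [hn.perm_eq]
        refine (hj _).symm.trans (congrArg x'.1.1 ?_)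
        exact (K.perm τ.tet i).apply_symm_apply j
    | refl a =>
      rintro τ τ' x x' rfl he h
      have hx : x.1 = x'.1 := congrArg (fun a : Σ _ : T, ModelTet => a.2) he
      have hx' : x = x' := Subtype.ext hx
      subst hx'
      have ht : τ.tet = τ'.tet := congrArg (fun a : Σ _ : T, ModelTet => a.1) he
      rw [eq_of_map_eq hp ht h]
    | symm a b _ ih =>
      intro τ τ' x x' ha hb h
      exact (ih τ' τ x' x hb ha h.symm).symm
    | trans a b c hab _ ih1 ih2 =>
      intro τ τ' x x' ha hc h
      obtain ⟨t, z⟩ := b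
      have hz : K.point τ.tet x.1 = K.point t z := by
        have := Quot.eqvGen_sound hab
        rw [ha] at this
        exact this
      -- The intermediate point represents the same point of the realisation, so it is not a vertex
      -- and lifts to `τ.map x`.
      have hz1 : ∀ i, z.1 i ≠ 1 :=
        K.ne_one_of_point_notMem (t := t) (hz ▸ K.point_not_mem_vertices _ x)
      obtain ⟨τ'', rfl, h''⟩ := exists_map_eq hp t ⟨z, hz1⟩ (y := τ.map x)
        ((τ.lifts x).trans (K.charMap_eq_iff.2 hz))
      exact (ih1 τ τ'' x ⟨z, hz1⟩ ha rfl h''.symm).trans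
        (ih2 τ'' τ' ⟨z, hz1⟩ x' rfl hc (h''.trans h))
  exact (key _ _ hg τ τ' x x' rfl rfl h).1 hx

/-- The interior of the universal cover has the weak topology given by the lifted tetrahedra. -/
theorem isOpen_of_isOpen_preimage (hp : IsCoveringMap p) (hB : IsClosed B) {Y : Set M'}
    (hY : Disjoint Y (p ⁻¹' B)) (h : ∀ τ : LiftedTet K p, IsOpen (τ.map ⁻¹' Y)) : IsOpen Y := by
  refine isOpen_iff_mem_nhds.2 fun y hy => ?_
  obtain ⟨O, hO, hyO, hs⟩ := hp.exists_section (p y)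
  obtain ⟨s, -, hps, hsy, hso⟩ := hs y hyO
  -- `W` is the trace of `Y` on the sheet through `y`, seen in `M`. Its openness can be checked in
  -- the realisation, where the quotient topology reduces it to the model tetrahedra.
  set W : Set M := {v | v ∈ O \ B ∧ s v ∈ Y} with hW
  have hyB : p y ∉ B := fun h' => disjoint_left.1 hY hy h'
  have hOB : IsOpen (s '' (O \ B)) := hso _ sdiff_subset (hO.sdiff hB)
  have h1 : ∀ t, IsOpen {x : PuncturedTet | K.charMap t x ∈ W} := by
    intro t
    refine isOpen_iff_mem_nhds.2 fun x hx => ?_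
    obtain ⟨τ, rfl, hτ⟩ := exists_map_eq hp t x (y := s (K.charMap t x)) (hps _ hx.1.1)
    have h2 : τ.map x ∈ Y ∩ s '' (O \ B) := hτ ▸ ⟨hx.2, mem_image_of_mem s hx.1⟩
    filter_upwards [((h τ).inter (hOB.preimage τ.map.continuous)).mem_nhds h2]
    rintro z ⟨hzY, v, hv, hvz⟩
    have hvz' : v = K.charMap τ.tet z := by rw [← hps v hv.1, hvz, τ.lifts]
    rw [mem_ofPred_eq, ← hvz']
    exact ⟨hv, hvz ▸ hzY⟩
  have hpunct : IsOpen {x : ModelTet | ∀ i, x.1 i ≠ 1} := by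
    simp only [ofPred_forall]
    exact isOpen_iInter_of_finite fun i => isOpen_ne_fun
      ((continuous_apply i).comp continuous_subtype_val) continuous_const
  have h2 : IsOpen (Subtype.val '' {v : {v : K.Realization // v ∉ K.vertices} |
      (K.homeo v).1 ∈ W}) := by
    rw [← isQuotientMap_quot_mk.isOpen_preimage, isOpen_sigma_iff]
    intro t
    convert! hpunct.isOpenMap_subtype_val _ (h1 t) using 1
    ext x
    constructor
    · rintro ⟨⟨v, hv⟩, hvW, rfl⟩
      exact ⟨⟨x, K.ne_one_of_point_notMem hv⟩, hvW, rfl⟩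
    · rintro ⟨x, hx, rfl⟩
      exact ⟨⟨K.point t x.1, K.point_not_mem_vertices t x⟩, hx, rfl⟩
  have h3 : IsOpen {v : {v : K.Realization // v ∉ K.vertices} | (K.homeo v).1 ∈ W} := by
    have := h2.preimage (continuous_subtype_val (p := fun v => v ∉ K.vertices))
    rwa [preimage_image_eq _ Subtype.val_injective] at this
  have h4 : IsOpen (Subtype.val ⁻¹' W : Set {m : M // m ∉ B}) := by
    rw [← K.homeo.isOpen_preimage]
    exact h3
  have h5 : IsOpen W := by
    have := hB.isOpen_compl.isOpenMap_subtype_val _ h4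
    convert! this using 1
    ext m
    constructor
    · intro hm
      exact ⟨⟨m, hm.1.2⟩, hm, rfl⟩
    · rintro ⟨m, hm, rfl⟩
      exact hm
  have h6 : s '' W ∈ 𝓝 y :=
    (hso W (fun v hv => hv.1.1) h5).mem_nhds ⟨p y, ⟨⟨hyO, hyB⟩, by rwa [hsy]⟩, hsy⟩
  refine mem_of_superset h6 ?_
  rintro _ ⟨v, hv, rfl⟩
  exact hv.2

/-- Any two lifted tetrahedra are connected by a gallery. -/
theorem mem_of_isNeighbour_closed (hp : IsCoveringMap p) (hB : IsClosed B)
    (hconn : IsPreconnected (p ⁻¹' B)ᶜ) {R : Set (LiftedTet K p)}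
    (hR : ∀ τ τ' i, τ.IsNeighbour i τ' → τ ∈ R → τ' ∈ R) {τ₀ : LiftedTet K p} (h₀ : τ₀ ∈ R)
    (τ : LiftedTet K p) : τ ∈ R := by
  have hR' : ∀ τ τ' i, τ.IsNeighbour i τ' → τ ∈ Rᶜ → τ' ∈ Rᶜ :=
    fun τ τ' i h hτ hτ' => hτ (hR _ _ _ h.symm hτ')
  -- For a family closed under neighbours, membership depends only on the point covered. Its union
  -- thus meets each tetrahedron in everything or nothing and is open; `R` and its complement would
  -- disconnect the interior.
  have hstar : ∀ S : Set (LiftedTet K p), (∀ τ τ' i, τ.IsNeighbour i τ' → τ ∈ S → τ' ∈ S) →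
      (∀ τ x, τ.map x ∈ {y | ∃ τ ∈ S, ∃ x, τ.map x = y} ↔ τ ∈ S) ∧
      IsOpen {y | ∃ τ ∈ S, ∃ x, τ.map x = y} := by
    intro S hS
    have h1 : ∀ τ x, τ.map x ∈ {y | ∃ τ ∈ S, ∃ x, τ.map x = y} ↔ τ ∈ S := by
      refine fun τ x => ⟨?_, fun h => ⟨τ, h, x, rfl⟩⟩
      rintro ⟨τ', hτ', x', h⟩
      exact of_map_eq hp (P := fun τ _ => τ ∈ S) (fun τ τ' i _ _ hn h => hS τ τ' i hn h) h hτ'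
    refine ⟨h1, isOpen_of_isOpen_preimage (K := K) hp hB ?_ fun τ => ?_⟩
    · rw [disjoint_left]
      rintro _ ⟨τ, -, x, rfl⟩
      exact τ.map_notMem x
    · by_cases hτ : τ ∈ S
      · convert isOpen_univ
        exact eq_univ_of_forall fun x => (h1 τ x).2 hτ
      · convert isOpen_empty
        exact eq_empty_of_forall_notMem fun x hx => hτ ((h1 τ x).1 hx)
  obtain ⟨h1, ho1⟩ := hstar R hR
  obtain ⟨h2, ho2⟩ := hstar Rᶜ hR'
  have x : PuncturedTet := Classical.arbitrary _
  by_contra hτ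
  obtain ⟨y, hy, hy1, hy2⟩ := hconn _ _ ho1 ho2
    (fun y hy => by
      obtain ⟨τ, x, rfl⟩ := exists_map_eq_of_notMem (K := K) hp hy
      exact (em (τ ∈ R)).imp (h1 τ x).2 (h2 τ x).2)
    ⟨τ₀.map x, τ₀.map_notMem x, (h1 _ _).2 h₀⟩ ⟨τ.map x, τ.map_notMem x, (h2 _ _).2 hτ⟩
  obtain ⟨τ', x', rfl⟩ := exists_map_eq_of_notMem (K := K) hp hy
  exact (h2 _ _).1 hy2 ((h1 _ _).1 hy1)

end LiftedTet

/-! ### Ideal vertices of the lifted triangulation -/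

namespace LiftedTet

variable {T M M' : Type*} [TopologicalSpace M] [TopologicalSpace M'] {B : Set M}
  {K : IdealTriangulation T B} {p : M' → M}

variable (K p) in
/-- The same ideal vertex, seen from two lifted tetrahedra that share a face at this vertex. -/
def FlagStep (a b : LiftedTet K p × Fin 4) : Prop :=
  ∃ k, k ≠ a.2 ∧ a.1.IsNeighbour k b.1 ∧ b.2 = K.perm a.1.tet k a.2

variable (K p) in
/-- The ideal vertices of the lifted triangulation. -/
def Cusp : Type _ := Quot (FlagStep K p)

/-- The ideal vertex at vertex `i` of `τ`. -/
def cusp (τ : LiftedTet K p) (i : Fin 4) : Cusp K p := Quot.mk _ (τ, i)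

theorem IsNeighbour.cusp_eq {τ τ' : LiftedTet K p} {k i : Fin 4} (h : τ.IsNeighbour k τ')
    (hi : i ≠ k) : τ'.cusp (K.perm τ.tet k i) = τ.cusp i :=
  (Quot.sound ⟨k, hi.symm, h, rfl⟩).symm

/-- The neighbourhood of an ideal vertex where its barycentric coordinate exceeds `δ`. -/
def cuspNhd (δ : ℝ) (v : Cusp K p) : Set M' :=
  {y | ∃ (τ : LiftedTet K p) (i : Fin 4) (x : PuncturedTet), τ.cusp i = v ∧ δ < x.1.1 i ∧
    τ.map x = y}

theorem map_mem_cuspNhd (hp : IsCoveringMap p) {δ : ℝ} (hδ : 0 ≤ δ) {v : Cusp K p}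
    {τ : LiftedTet K p} {x : PuncturedTet} :
    τ.map x ∈ cuspNhd δ v ↔ ∃ i, τ.cusp i = v ∧ δ < x.1.1 i := by
  constructor
  · rintro ⟨τ', i, x', hv, hi, h⟩
    refine of_map_eq hp (P := fun τ x => ∃ i, τ.cusp i = v ∧ δ < x.1.1 i) ?_ h ⟨i, hv, hi⟩
    rintro τ τ' k x hk hn ⟨i, hv, hi⟩
    -- A coordinate above `δ ≥ 0` does not vanish, so the crossed face contains the vertex and
    -- crossing preserves the ideal vertex.
    have hik : i ≠ k := by rintro rfl; linarith
    exact ⟨_, (hn.cusp_eq hik).trans hv, by rwa [PuncturedTet.reindex_apply]⟩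
  · rintro ⟨i, hv, hi⟩
    exact ⟨τ, i, x, hv, hi, rfl⟩

theorem cuspNhd_anti {δ δ' : ℝ} (h : δ ≤ δ') (v : Cusp K p) : cuspNhd δ' v ⊆ cuspNhd δ v := by
  rintro _ ⟨τ, i, x, hv, hi, rfl⟩
  exact ⟨τ, i, x, hv, h.trans_lt hi, rfl⟩

theorem disjoint_cuspNhd_boundary (δ : ℝ) (v : Cusp K p) : Disjoint (cuspNhd δ v) (p ⁻¹' B) := by
  rw [disjoint_left]
  rintro _ ⟨τ, i, x, -, -, rfl⟩
  exact τ.map_notMem x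

theorem eq_of_mem_cuspNhd (hp : IsCoveringMap p) {v w : Cusp K p} {y : M'}
    (hv : y ∈ cuspNhd (1 / 2) v) (hw : y ∈ cuspNhd (1 / 2) w) : v = w := by
  obtain ⟨τ, i, x, rfl, hi, rfl⟩ := hv
  obtain ⟨j, rfl, hj⟩ := (map_mem_cuspNhd hp (by norm_num)).1 hw
  rw [x.eq_of_half_lt hi hj]

theorem isOpen_cuspNhd (hp : IsCoveringMap p) (hB : IsClosed B) {δ : ℝ} (hδ : 0 ≤ δ)
    (v : Cusp K p) : IsOpen (cuspNhd δ v) := by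
  refine isOpen_of_isOpen_preimage (K := K) hp hB (disjoint_cuspNhd_boundary δ v) fun τ => ?_
  have : τ.map ⁻¹' cuspNhd δ v = ⋃ i, ⋃ _ : τ.cusp i = v, {x | δ < x.1.1 i} := by
    ext x
    simp [map_mem_cuspNhd hp hδ]
  rw [this]
  exact isOpen_iUnion fun i => isOpen_iUnion fun _ => PuncturedTet.isOpen_corner i δ

/-- Corners are convex, and two corners related by `FlagStep` share points of the common face near
the vertex. Chains of such steps join any two corners at `v`. -/
theorem isPreconnected_cuspNhd {δ : ℝ} (hδ : δ < 1) (v : Cusp K p) : IsPreconnected (cuspNhd δ v) := by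
  have corner : ∀ (τ : LiftedTet K p) (i : Fin 4),
      IsPreconnected (τ.map '' {x | δ < x.1.1 i}) ∧
      τ.map '' {x | δ < x.1.1 i} ⊆ cuspNhd δ (τ.cusp i) := by
    refine fun τ i => ⟨(PuncturedTet.isPreconnected_corner i δ).image _
      τ.map.continuous.continuousOn, ?_⟩
    rintro _ ⟨x, hx, rfl⟩
    exact ⟨τ, i, x, rfl, hx, rfl⟩
  have key : ∀ a b : LiftedTet K p × Fin 4, Relation.EqvGen (FlagStep K p) a b →
      a.1.cusp a.2 = b.1.cusp b.2 ∧
      ∃ t, IsPreconnected t ∧ t ⊆ cuspNhd δ (a.1.cusp a.2) ∧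
        a.1.map '' {x | δ < x.1.1 a.2} ⊆ t ∧ b.1.map '' {x | δ < x.1.1 b.2} ⊆ t := by
    intro a b hab
    induction hab with
    | rel a b h =>
      have hc : a.1.cusp a.2 = b.1.cusp b.2 := Quot.sound h
      obtain ⟨k, hk, hn, hb⟩ := h
      obtain ⟨x, hx, hx0⟩ := PuncturedTet.exists_lt_and_eq_zero hk.symm hδ
      refine ⟨hc, _, (corner a.1 a.2).1.union (a.1.map x) (mem_image_of_mem _ hx) ?_
        (corner b.1 b.2).1, union_subset (corner a.1 a.2).2 (hc ▸ (corner b.1 b.2).2),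
        subset_union_left, subset_union_right⟩
      refine ⟨x.reindex (K.perm a.1.tet k), ?_, hn.map_reindex hx0⟩
      change δ < _
      rwa [hb, PuncturedTet.reindex_apply]
    | refl a =>
      exact ⟨rfl, _, (corner a.1 a.2).1, (corner a.1 a.2).2, subset_rfl, subset_rfl⟩
    | symm a b _ ih =>
      obtain ⟨hc, t, ht, hts, ha, hb⟩ := ih
      exact ⟨hc.symm, t, ht, hc ▸ hts, hb, ha⟩
    | trans a b c _ _ ih1 ih2 =>
      obtain ⟨hc1, t1, ht1, hts1, ha1, hb1⟩ := ih1
      obtain ⟨hc2, t2, ht2, hts2, hb2, hc⟩ := ih2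
      obtain ⟨x, hx⟩ := PuncturedTet.exists_corner b.2 hδ
      have hxb := mem_image_of_mem b.1.map (show x ∈ {x : PuncturedTet | δ < x.1.1 b.2} from hx)
      exact ⟨hc1.trans hc2, _, ht1.union _ (hb1 hxb) (hb2 hxb) ht2,
        union_subset hts1 (hc1 ▸ hts2), ha1.trans subset_union_left, hc.trans subset_union_right⟩
  refine isPreconnected_of_forall_pair ?_
  rintro _ ⟨τ, i, x, hv, hx, rfl⟩ _ ⟨τ', i', x', hv', hx', rfl⟩
  obtain ⟨-, t, ht, hts, h1, h2⟩ := key (τ, i) (τ', i') (Quot.eqvGen_exact (hv.trans hv'.symm))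
  exact ⟨t, hv ▸ hts, h1 ⟨x, hx, rfl⟩, h2 ⟨x', hx', rfl⟩, ht⟩

variable (K) in
/-- The neighbourhood of the boundary where some barycentric coordinate exceeds `δ`. -/
def baseNhd (δ : ℝ) : Set M := {m | ∀ t x, K.charMap t x = m → ∃ i, δ < x.1.1 i}

theorem boundary_subset_baseNhd (δ : ℝ) : B ⊆ baseNhd K δ := by
  rintro _ hm t x rfl
  exact absurd hm (K.charMap_notMem t x)

/-- The complement is a finite union of images of truncated tetrahedra, which are compact. -/
theorem isOpen_baseNhd [T2Space M] [Finite T] {δ : ℝ} (hδ : δ < 1) : IsOpen (baseNhd K δ) := by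
  have h1 : (baseNhd K δ)ᶜ = ⋃ t, K.charMap t '' {x | ∀ i, x.1.1 i ≤ δ} := by
    ext m
    simp only [baseNhd, mem_compl_iff, mem_ofPred_eq, mem_iUnion, mem_image]
    push Not
    exact ⟨fun ⟨t, x, h, hx⟩ => ⟨t, x, hx, h⟩, fun ⟨t, x, hx, h⟩ => ⟨t, x, h, hx⟩⟩
  rw [← isClosed_compl_iff, h1]
  refine isClosed_iUnion_of_finite fun t => IsCompact.isClosed ?_
  refine IsCompact.image ?_ (K.continuous_charMap t)
  have hi : IsInducing (Subtype.val : PuncturedTet → ModelTet) := IsInducing.subtypeVal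
  rw [hi.isCompact_iff]
  have h2 : Subtype.val '' {x : PuncturedTet | ∀ i, x.1.1 i ≤ δ} =
      {x : ModelTet | ∀ i, x.1 i ≤ δ} := by
    ext x
    constructor
    · rintro ⟨x, hx, rfl⟩
      exact hx
    · intro hx
      exact ⟨⟨x, fun i => ne_of_lt ((hx i).trans_lt hδ)⟩, hx, rfl⟩
  rw [h2]
  simp only [ofPred_forall]
  exact (isClosed_iInter fun i => isClosed_le
    ((continuous_apply i).comp continuous_subtype_val) continuous_const).isCompact

theorem exists_mem_cuspNhd (hp : IsCoveringMap p) {δ : ℝ} {y : M'} (hy : p y ∈ baseNhd K δ)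
    (hyA : y ∉ p ⁻¹' B) : ∃ v : Cusp K p, y ∈ cuspNhd δ v := by
  obtain ⟨τ, x, rfl⟩ := exists_map_eq_of_notMem (K := K) hp hyA
  obtain ⟨i, hi⟩ := hy τ.tet x (τ.lifts x).symm
  exact ⟨τ.cusp i, τ, i, x, rfl, hi, rfl⟩

theorem cuspNhd_subset_preimage_baseNhd (hp : IsCoveringMap p) {δ : ℝ} (hδ : 0 ≤ δ)
    (v : Cusp K p) : cuspNhd δ v ⊆ p ⁻¹' baseNhd K δ := by
  intro y hy t x hx
  obtain ⟨τ, rfl, rfl⟩ := exists_map_eq hp t x hx.symm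
  obtain ⟨i, -, hi⟩ := (map_mem_cuspNhd hp hδ).1 hy
  exact ⟨i, hi⟩

/-- The compact complement of `U` is exhausted by increasing open sets on which all coordinates stay
below some `δ < 1`. These sets are built in the cover, where the weak topology is available, and
pushed down by the open map `p`. -/
theorem exists_baseNhd_subset [PreconnectedSpace M] [CompactSpace M] [Nonempty M']
    (hp : IsCoveringMap p) (hB : IsClosed B) {U : Set M} (hU : IsOpen U) (hBU : B ⊆ U) :
    ∃ δ, 1 / 2 ≤ δ ∧ δ < 1 ∧ baseNhd K δ ⊆ U := by
  set Y : Iio (1 : ℝ) → Set M' := fun δ =>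
    {y | y ∉ p ⁻¹' B ∧ ∀ (τ : LiftedTet K p) x, τ.map x = y → ∀ i, x.1.1 i < δ} with hY
  have hmem : ∀ (δ : Iio (1 : ℝ)) (τ : LiftedTet K p) x,
      τ.map x ∈ Y δ ↔ ∀ i, x.1.1 i < δ := by
    refine fun δ τ x => ⟨fun h => h.2 τ x rfl, fun h => ⟨τ.map_notMem x, fun τ' x' h' => ?_⟩⟩
    refine of_map_eq hp (P := fun _ x => ∀ i, x.1.1 i < δ) (fun _ _ k x _ _ h i => ?_) h'.symm h
    exact h _
  have hYo : ∀ δ, IsOpen (Y δ) := by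
    refine fun δ => isOpen_of_isOpen_preimage (K := K) hp hB
      (disjoint_left.2 fun y hy => hy.1) fun τ => ?_
    have : τ.map ⁻¹' Y δ = ⋂ i, {x : PuncturedTet | x.1.1 i < δ.1} := by
      ext x
      simp [hmem]
    rw [this]
    exact isOpen_iInter_of_finite fun i =>
      isOpen_lt (PuncturedTet.continuous_coord i) continuous_const
  have hmono : Monotone fun δ => p '' Y δ := by
    intro δ δ' h
    exact image_mono fun y hy => ⟨hy.1, fun τ x e i => (hy.2 τ x e i).trans_le h⟩
  have : Nonempty (Iio (1 : ℝ)) := ⟨⟨0, mem_Iio.2 one_pos⟩⟩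
  obtain ⟨δ, hδ⟩ := hU.isClosed_compl.isCompact.elim_directed_cover (fun δ => p '' Y δ)
    (fun δ => hp.isOpenMap _ (hYo δ)) (fun m hm => by
      obtain ⟨y, rfl⟩ := hp.surjective m
      obtain ⟨τ, x, rfl⟩ := exists_map_eq_of_notMem (K := K) hp (fun h : p y ∈ B => hm (hBU h))
      have h1 : ∀ᶠ δ : ℝ in 𝓝[<] 1, ∀ i, x.1.1 i < δ :=
        eventually_all.2 fun i => nhdsWithin_le_nhds (lt_mem_nhds (x.lt_one i))
      obtain ⟨δ, hδ, hδ1⟩ := (h1.and self_mem_nhdsWithin).exists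
      exact mem_iUnion.2 ⟨⟨δ, hδ1⟩, _, (hmem _ _ _).2 hδ, rfl⟩) hmono.directed_le
  refine ⟨max (1 / 2) δ, le_max_left _ _, max_lt (by norm_num) δ.2, fun m hm => ?_⟩
  by_contra hmU
  obtain ⟨y, hy, rfl⟩ := hδ hmU
  obtain ⟨τ, x, rfl⟩ := exists_map_eq_of_notMem (K := K) hp hy.1
  obtain ⟨i, hi⟩ := hm τ.tet x (τ.lifts x).symm
  exact lt_asymm ((le_max_right _ _).trans_lt hi) ((hmem _ _ _).1 hy i)

/-- Off the boundary, the preimage of `baseNhd K δ` is the disjoint union of the open sets `cuspNhd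
δ w`, so a connected subset stays in one of them. The bound 1/2 makes them disjoint. -/
theorem subset_cuspNhd_of_isPreconnected (hp : IsCoveringMap p) (hB : IsClosed B) {δ : ℝ}
    (hδ : 1 / 2 ≤ δ) {S : Set M'} (hS : IsPreconnected S) (hSA : Disjoint S (p ⁻¹' B))
    (hSδ : S ⊆ p ⁻¹' baseNhd K δ) {v : Cusp K p} (hv : (S ∩ cuspNhd (1 / 2) v).Nonempty) :
    S ⊆ cuspNhd δ v := by
  have hδ0 : 0 ≤ δ := by linarith
  obtain ⟨y, hyS, hy⟩ := hv
  obtain ⟨w, hw⟩ := exists_mem_cuspNhd hp (hSδ hyS) (disjoint_left.1 hSA hyS)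
  obtain rfl := eq_of_mem_cuspNhd hp hy (cuspNhd_anti hδ w hw)
  have ho : IsOpen (⋃ w, ⋃ _ : w ≠ v, cuspNhd δ w) :=
    isOpen_iUnion fun w => isOpen_iUnion fun _ => isOpen_cuspNhd hp hB hδ0 w
  refine hS.subset_left_of_subset_union (isOpen_cuspNhd hp hB hδ0 v) ho ?_ ?_ ⟨y, hyS, hw⟩
  · rw [disjoint_left]
    intro z hz hz'
    simp only [mem_iUnion] at hz'
    obtain ⟨w, hwv, hz'⟩ := hz'
    exact hwv (eq_of_mem_cuspNhd hp (cuspNhd_anti hδ w hz') (cuspNhd_anti hδ v hz))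
  · intro z hz
    obtain ⟨w, hw⟩ := exists_mem_cuspNhd hp (hSδ hz) (disjoint_left.1 hSA hz)
    by_cases hwv : w = v
    · exact Or.inl (hwv ▸ hw)
    · exact Or.inr (mem_iUnion₂.2 ⟨w, hwv, hw⟩)

/-- The neighbourhood of an ideal vertex, completed by the boundary there. -/
def cuspRegion (v : Cusp K p) : Set M' := interior (cuspNhd (1 / 2) v ∪ p ⁻¹' B)

theorem cuspNhd_subset_cuspRegion (hp : IsCoveringMap p) (hB : IsClosed B) (v : Cusp K p) :
    cuspNhd (1 / 2) v ⊆ cuspRegion v :=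
  interior_maximal subset_union_left (isOpen_cuspNhd hp hB (by norm_num) v)

theorem eq_of_mem_cuspRegion (hp : IsCoveringMap p) (hA : interior (p ⁻¹' B) = ∅)
    {v w : Cusp K p} {y : M'} (hv : y ∈ cuspRegion v) (hw : y ∈ cuspRegion w) : v = w := by
  by_contra hvw
  have h : y ∈ interior (p ⁻¹' B) := by
    have hy : y ∈ cuspRegion v ∩ cuspRegion w := ⟨hv, hw⟩
    rw [cuspRegion, cuspRegion, ← interior_inter] at hy
    refine interior_mono ?_ hy
    rintro z ⟨h1 | h1, h2 | h2⟩
    · exact absurd (eq_of_mem_cuspNhd hp h1 h2) hvw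
    all_goals assumption
  rw [hA] at h
  exact h

/-- A small half ball minus the boundary is connected and so lies near a single ideal vertex. -/
theorem exists_mem_cuspRegion [T2Space M] [Finite T] (hp : IsCoveringMap p)
    (hM : IsThreeManifoldWithBoundary M B) {y : M'} (hy : p y ∈ baseNhd K (1 / 2)) :
    ∃ v : Cusp K p, y ∈ cuspRegion v := by
  have hB := hM.isClosed_boundary
  have hU : p ⁻¹' baseNhd K (1 / 2) ∈ 𝓝 y :=
    ((isOpen_baseNhd (by norm_num)).preimage hp.continuous).mem_nhds hy
  obtain ⟨V, hVo, hyV, hVU, -, hV, ⟨z, hzV, hzA⟩, -⟩ :=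
    (hM.preimage hp.isLocalHomeomorph).exists_preconnected_nhd y hU
  obtain ⟨v, hv⟩ := exists_mem_cuspNhd hp (hVU hzV) hzA
  have h1 := subset_cuspNhd_of_isPreconnected hp hB le_rfl hV disjoint_sdiff_left
    (sdiff_subset.trans hVU) ⟨z, ⟨hzV, hzA⟩, hv⟩
  refine ⟨v, mem_interior.2 ⟨V, fun w hw => ?_, hVo, hyV⟩⟩
  exact (em (w ∈ p ⁻¹' B)).elim Or.inr fun hwA => Or.inl (h1 ⟨hw, hwA⟩)

theorem subset_cuspRegion_of_isPreconnected [T2Space M] [Finite T] (hp : IsCoveringMap p)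
    (hM : IsThreeManifoldWithBoundary M B) {S : Set M'} (hS : IsPreconnected S)
    (hSU : S ⊆ p ⁻¹' baseNhd K (1 / 2)) {v : Cusp K p} (hv : (S ∩ cuspRegion v).Nonempty) :
    S ⊆ cuspRegion v := by
  have hA := (hM.preimage hp.isLocalHomeomorph).interior_boundary
  refine hS.subset_left_of_subset_union isOpen_interior (v := ⋃ w, ⋃ _ : w ≠ v, cuspRegion w)
    (isOpen_iUnion fun w => isOpen_iUnion fun _ => isOpen_interior) ?_ ?_ hv
  · rw [disjoint_left]
    intro z hz hz'
    simp only [mem_iUnion] at hz'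
    obtain ⟨w, hwv, hz'⟩ := hz'
    exact hwv (eq_of_mem_cuspRegion hp hA hz' hz)
  · intro z hz
    obtain ⟨w, hw⟩ := exists_mem_cuspRegion hp hM (hSU hz)
    by_cases hwv : w = v
    · exact Or.inl (hwv ▸ hw)
    · exact Or.inr (mem_iUnion₂.2 ⟨w, hwv, hw⟩)

theorem mem_cuspRegion_of_mk_eq [T2Space M] [Finite T] (hp : IsCoveringMap p)
    (hM : IsThreeManifoldWithBoundary M B) {b b' : p ⁻¹' B}
    (h : ConnectedComponents.mk b' = ConnectedComponents.mk b) {v : Cusp K p}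
    (hb : b.1 ∈ cuspRegion v) : b'.1 ∈ cuspRegion v := by
  have h1 : IsPreconnected (Subtype.val '' connectedComponent b) :=
    isPreconnected_connectedComponent.image _ continuous_subtype_val.continuousOn
  refine subset_cuspRegion_of_isPreconnected hp hM h1 ?_
    ⟨b.1, ⟨b, mem_connectedComponent, rfl⟩, hb⟩
    ⟨b', ConnectedComponents.coe_eq_coe'.1 h, rfl⟩
  rintro _ ⟨c, -, rfl⟩
  exact boundary_subset_baseNhd _ c.2

/-- This replaces a condition on all neighbourhoods `U` by one membership. Forwards, `U = baseNhd K
(1 / 2)` suffices; backwards, a half ball at the boundary point is joined to a connected `cuspNhd δ`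
inside the preimage of `U`. -/
theorem vertexAt_iff [T2Space M] [CompactSpace M] [ConnectedSpace M] [Nonempty M'] [Finite T]
    (hp : IsCoveringMap p) (hM : IsThreeManifoldWithBoundary M B) {τ : LiftedTet K p} {i : Fin 4}
    {b : p ⁻¹' B} : τ.VertexAt i (ConnectedComponents.mk b) ↔ b.1 ∈ cuspRegion (τ.cusp i) := by
  have hB := hM.isClosed_boundary
  have half : (1 / 2 : ℝ) < 1 := by norm_num
  constructor
  · intro h
    have h1 := h b rfl _ (isOpen_baseNhd half) (boundary_subset_baseNhd (K := K) (1 / 2))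
    obtain ⟨x, hx, hxi⟩ := (h1.and (PuncturedTet.eventually_corner i half)).exists
    refine subset_cuspRegion_of_isPreconnected hp hM isPreconnected_connectedComponentIn
      (connectedComponentIn_subset _ _)
      ⟨_, hx, cuspNhd_subset_cuspRegion hp hB _ ⟨τ, i, x, rfl, hxi, rfl⟩⟩
      (mem_connectedComponentIn (boundary_subset_baseNhd _ b.2))
  · intro h b' hb' U hU hBU
    have h' := mem_cuspRegion_of_mk_eq hp hM hb' h
    obtain ⟨δ, hδ2, hδ1, hδU⟩ := exists_baseNhd_subset (K := K) hp hB hU hBU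
    have hnhd : p ⁻¹' baseNhd K δ ∩ cuspRegion (τ.cusp i) ∈ 𝓝 b'.1 :=
      (((isOpen_baseNhd hδ1).preimage hp.continuous).inter isOpen_interior).mem_nhds
        ⟨boundary_subset_baseNhd _ b'.2, h'⟩
    obtain ⟨V, -, hbV, hVU, hV, hVA, ⟨z, hzV, hzA⟩, -⟩ :=
      (hM.preimage hp.isLocalHomeomorph).exists_preconnected_nhd b'.1 hnhd
    have hz : z ∈ cuspNhd (1 / 2) (τ.cusp i) := (interior_subset (hVU hzV).2).resolve_right hzA
    have h1 := subset_cuspNhd_of_isPreconnected hp hB hδ2 hVA disjoint_sdiff_left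
      (sdiff_subset.trans fun w hw => (hVU hw).1) ⟨z, ⟨hzV, hzA⟩, hz⟩
    have hδ0 : 0 ≤ δ := by linarith
    have h2 := hV.union z hzV (h1 ⟨hzV, hzA⟩) (isPreconnected_cuspNhd hδ1 (τ.cusp i))
    have h3 := h2.subset_connectedComponentIn (F := p ⁻¹' U) (Or.inl hbV) (union_subset
      (fun w hw => hδU (hVU hw).1)
      ((cuspNhd_subset_preimage_baseNhd hp hδ0 _).trans (preimage_mono hδU)))
    filter_upwards [PuncturedTet.eventually_corner i hδ1] with x hx
    exact h3 (Or.inr ⟨τ, i, x, rfl, hx, rfl⟩)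

/-- There is boundary at each ideal vertex. -/
theorem exists_boundary_mem_cuspRegion [T2Space M] [CompactSpace M] [ConnectedSpace M]
    [Nonempty M'] [Finite T] (hp : IsCoveringMap p) (hM : IsThreeManifoldWithBoundary M B)
    (v : Cusp K p) : ∃ b : p ⁻¹' B, b.1 ∈ cuspRegion v := by
  have hB := hM.isClosed_boundary
  have half : (1 / 2 : ℝ) < 1 := by norm_num
  induction v using Quot.ind with
  | mk a =>
    obtain ⟨τ, i⟩ := a
    change ∃ b : p ⁻¹' B, b.1 ∈ cuspRegion (τ.cusp i)
    set l := comap (Subtype.val : PuncturedTet → ModelTet) (𝓝 (modelVertex i)) with hl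
    have hcorner : ∀ {δ : ℝ}, 0 ≤ δ → δ < 1 → ∀ᶠ x in l, K.charMap τ.tet x ∈ baseNhd K δ := by
      intro δ hδ0 hδ1
      filter_upwards [PuncturedTet.eventually_corner i hδ1] with x hx
      rw [← τ.lifts]
      exact cuspNhd_subset_preimage_baseNhd hp hδ0 (τ.cusp i) ⟨τ, i, x, rfl, hx, rfl⟩
    -- A cluster point of the tetrahedron at its missing vertex must lie in `B`, as it cannot be
    -- separated from `B`. A connected neighbourhood of it is then lifted to the sheet through a
    -- point of the corner.
    obtain ⟨m, hm⟩ := exists_clusterPt_of_compactSpace (Filter.map (K.charMap τ.tet) l)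
    have hm' : ∀ V ∈ 𝓝 m, ∃ᶠ x in l, K.charMap τ.tet x ∈ V := fun V hV =>
      (clusterPt_iff_frequently.1 hm) V hV
    have hmB : m ∈ B := by
      by_contra hmB
      obtain ⟨U, V, hU, hV, hBU, hmV, hUV⟩ :=
        SeparatedNhds.of_isCompact_isCompact hB.isCompact isCompact_singleton
          (disjoint_singleton_right.2 hmB)
      obtain ⟨δ, hδ2, hδ1, hδU⟩ := exists_baseNhd_subset (K := K) hp hB hU hBU
      obtain ⟨x, hx1, hx2⟩ := ((hm' V (hV.mem_nhds (hmV rfl))).and_eventually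
        (hcorner (by linarith) hδ1)).exists
      exact disjoint_left.1 hUV (hδU hx2) hx1
    obtain ⟨O, hO, hmO, hs⟩ := hp.exists_section m
    obtain ⟨V, hVo, hmV, hVO, hV, -, -, -⟩ := hM.exists_preconnected_nhd m
      (inter_mem (hO.mem_nhds hmO)
        ((isOpen_baseNhd half).mem_nhds (boundary_subset_baseNhd (K := K) _ hmB)))
    obtain ⟨x, hx1, hx2⟩ := ((hm' V (hVo.mem_nhds hmV)).and_eventually
      (PuncturedTet.eventually_corner i half)).exists
    rw [← τ.lifts] at hx1
    obtain ⟨s, hsc, hps, hsx, -⟩ := hs (τ.map x) (hVO hx1).1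
    refine ⟨⟨s m, by rwa [mem_preimage, hps m hmO]⟩, ?_⟩
    refine subset_cuspRegion_of_isPreconnected hp hM
      (hV.image s (hsc.mono fun w hw => (hVO hw).1)) ?_
      ⟨τ.map x, ⟨_, hx1, hsx⟩, cuspNhd_subset_cuspRegion hp hB _ ⟨τ, i, x, rfl, hx2, rfl⟩⟩
      ⟨m, hmV, rfl⟩
    rintro _ ⟨w, hw, rfl⟩
    rw [mem_preimage, hps w (hVO hw).1]
    exact (hVO hw).2

end LiftedTet

/-! ### Separating the components of the boundary of the universal cover -/

section Separation

variable {M M' : Type*} [TopologicalSpace M] [TopologicalSpace M'] {p : M' → M} {B : Set M}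

theorem IsThreeManifoldWithBoundary.locallyConnectedSpace_boundary
    (hM : IsThreeManifoldWithBoundary M B) : LocallyConnectedSpace B := by
  rw [locallyConnectedSpace_iff_connected_subsets]
  intro b U hU
  rw [nhds_subtype, mem_comap] at hU
  obtain ⟨U', hU', hUU⟩ := hU
  obtain ⟨V, hVo, hbV, hVU, -, -, -, hV⟩ := hM.exists_preconnected_nhd b.1 hU'
  refine ⟨Subtype.val ⁻¹' V, (hVo.preimage continuous_subtype_val).mem_nhds hbV, ?_,
    (preimage_mono hVU).trans hUU⟩
  rw [← Topology.IsInducing.subtypeVal.isPreconnected_image, Subtype.image_preimage_coe, inter_comm]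
  exact hV

/-- Near `C`, the decomposition of `p⁻¹(B)` by `W₁` and `W₂` extends to a neighbourhood. -/
def Separates (p : M' → M) (B : Set M) (W₁ W₂ : Set M') (C : Set M) : Prop :=
  ∃ (U : Set M) (S R : Set M'), IsOpen U ∧ IsOpen S ∧ IsOpen R ∧ C ⊆ U ∧ Disjoint S R ∧
    p ⁻¹' U ⊆ S ∪ R ∧ S ∩ p ⁻¹' B ⊆ W₁ ∧ R ∩ p ⁻¹' B ⊆ W₂

variable {W₁ W₂ : Set M'}

theorem Separates.mono {C C' : Set M} (h : Separates p B W₁ W₂ C) (hC : C' ⊆ C) :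
    Separates p B W₁ W₂ C' := by
  obtain ⟨U, S, R, hU, hS, hR, hCU, h⟩ := h
  exact ⟨U, S, R, hU, hS, hR, hC.trans hCU, h⟩

/-- Sort the sheets over a small half ball `V` according to which of `W₁`, `W₂` contains the lift of
`m`. Since `V ∩ B` is connected, the whole boundary part of a sheet falls on the same side. -/
theorem separates_nhd (hp : IsCoveringMap p) (hM : IsThreeManifoldWithBoundary M B)
    (hW₁ : IsOpen W₁) (hW₂ : IsOpen W₂) (hW : p ⁻¹' B ⊆ W₁ ∪ W₂)
    (hdis : p ⁻¹' B ∩ (W₁ ∩ W₂) = ∅) {m : M} (hm : m ∈ B) :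
    ∃ V ∈ 𝓝 m, Separates p B W₁ W₂ V := by
  obtain ⟨O, hO, hmO, hs⟩ := hp.exists_section m
  obtain ⟨V, hVo, hmV, hVO, hV, -, -, hVB⟩ := hM.exists_preconnected_nhd m (hO.mem_nhds hmO)
  set F : Set M' → Set (M → M') := fun W =>
    {s | ContinuousOn s V ∧ (∀ v ∈ V, p (s v) = v) ∧ IsOpen (s '' V) ∧ s m ∈ W} with hF
  have hFo : ∀ W, IsOpen (⋃ s ∈ F W, s '' V) := fun W =>
    isOpen_biUnion fun s hs => hs.2.2.1
  have hFB : ∀ W W', IsOpen W → IsOpen W' → p ⁻¹' B ⊆ W ∪ W' → p ⁻¹' B ∩ (W ∩ W') = ∅ →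
      (⋃ s ∈ F W, s '' V) ∩ p ⁻¹' B ⊆ W := by
    rintro W W' hW hW' hWW hd y ⟨hy, hyB⟩
    obtain ⟨s, ⟨hsc, hps, -, hsm⟩, v, hv, rfl⟩ := mem_iUnion₂.1 hy
    rw [mem_preimage, hps v hv] at hyB
    have hsub : s '' (V ∩ B) ⊆ p ⁻¹' B := by
      rintro _ ⟨w, hw, rfl⟩
      rw [mem_preimage, hps w hw.1]
      exact hw.2
    have h1 := isPreconnected_iff_subset_of_disjoint.1
      (hVB.image s (hsc.mono inter_subset_left)) W W' hW hW' (hsub.trans hWW)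
      (subset_empty_iff.1 fun z hz => hd.subset ⟨hsub hz.1, hz.2⟩)
    refine h1.elim (fun h => h ⟨v, ⟨hv, hyB⟩, rfl⟩) fun h => ?_
    have h2 : s m ∈ p ⁻¹' B ∩ (W ∩ W') :=
      ⟨hsub ⟨m, ⟨hmV, hm⟩, rfl⟩, hsm, h ⟨m, ⟨hmV, hm⟩, rfl⟩⟩
    rw [hd] at h2
    exact h2.elim
  refine ⟨V, hVo.mem_nhds hmV, V, ⋃ s ∈ F (W₁ ∩ p ⁻¹' B), s '' V, ⋃ s ∈ F (W₂ ∩ p ⁻¹' B), s '' V,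
    hVo, hFo _, hFo _, subset_rfl, ?_, ?_, ?_, ?_⟩
  · rw [disjoint_left]
    intro y hy hy'
    obtain ⟨s, ⟨hsc, hps, -, hsm⟩, v, hv, rfl⟩ := mem_iUnion₂.1 hy
    obtain ⟨s', ⟨hsc', hps', -, hsm'⟩, v', hv', hvv⟩ := mem_iUnion₂.1 hy'
    have : v' = v := by rw [← hps v hv, ← hvv, hps' v' hv']
    subst this
    have h1 := hp.eqOn_of_comp_eqOn hV hsc hsc'
      (fun w hw => (hps w hw).trans (hps' w hw).symm) hv hvv.symm hmV
    have h2 : s m ∈ p ⁻¹' B ∩ (W₁ ∩ W₂) := ⟨hsm.2, hsm.1, h1 ▸ hsm'.1⟩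
    rw [hdis] at h2
    exact h2
  · intro y hy
    obtain ⟨s, hsc, hps, hsy, hso⟩ := hs y (hVO hy)
    have hsF : ∀ W, s m ∈ W → y ∈ ⋃ s ∈ F W, s '' V := fun W hW =>
      mem_iUnion₂.2 ⟨s, ⟨hsc.mono hVO, fun v hv => hps v (hVO hv), hso V hVO hVo, hW⟩,
        p y, hy, hsy⟩
    have hsB : s m ∈ p ⁻¹' B := by rwa [mem_preimage, hps m hmO]
    exact (hW hsB).imp (fun h => hsF _ ⟨h, hsB⟩) (fun h => hsF _ ⟨h, hsB⟩)
  · refine Subset.trans ?_ (hFB W₁ W₂ hW₁ hW₂ hW hdis)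
    exact inter_subset_inter_left _ (biUnion_mono (fun s hs => ⟨hs.1, hs.2.1, hs.2.2.1, hs.2.2.2.1⟩)
      fun _ _ => subset_rfl)
  · refine Subset.trans ?_ (hFB W₂ W₁ hW₂ hW₁ (by rwa [union_comm]) (by rwa [inter_comm W₂]))
    exact inter_subset_inter_left _ (biUnion_mono (fun s hs => ⟨hs.1, hs.2.1, hs.2.2.1, hs.2.2.2.1⟩)
      fun _ _ => subset_rfl)

theorem Separates.union [T2Space M] [CompactSpace M] (hp : IsCoveringMap p)
    (hM : IsThreeManifoldWithBoundary M B) (hdis : p ⁻¹' B ∩ (W₁ ∩ W₂) = ∅) {C₁ C₂ : Set M}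
    (hC₁ : IsClosed C₁) (hC₂ : IsClosed C₂) (hCB : C₁ ⊆ B)
    (h₁ : Separates p B W₁ W₂ C₁) (h₂ : Separates p B W₁ W₂ C₂) :
    Separates p B W₁ W₂ (C₁ ∪ C₂) := by
  obtain ⟨U₁, S₁, R₁, hU₁, hS₁, hR₁, hCU₁, hd₁, hc₁, hSW₁, hRW₁⟩ := h₁
  obtain ⟨U₂, S₂, R₂, hU₂, hS₂, hR₂, hCU₂, hd₂, hc₂, hSW₂, hRW₂⟩ := h₂
  -- `D` is where the two decompositions disagree, and `E` is the part of the overlap with no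
  -- disagreement above it. `E` is open because disagreement is constant along connected sheets, and
  -- it contains the overlap within `B`.
  set D : Set M' := (S₁ ∩ R₂) ∪ (R₁ ∩ S₂) with hD
  set E : Set M := (U₁ ∩ U₂) \ p '' D with hE
  have hEo : IsOpen E := by
    refine isOpen_iff_mem_nhds.2 fun m hm => ?_
    obtain ⟨O, hO, hmO, hs⟩ := hp.exists_section m
    obtain ⟨V, hVo, hmV, hVO, hV, -⟩ := hM.exists_preconnected_nhd m
      (inter_mem (hO.mem_nhds hmO) ((hU₁.inter hU₂).mem_nhds hm.1))
    refine mem_of_superset (hVo.mem_nhds hmV) fun v hv => ⟨(hVO hv).2, ?_⟩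
    rintro ⟨y, hy, rfl⟩
    obtain ⟨s, hsc, hps, hsy, -⟩ := hs y (hVO hv).1
    have hsV := hV.image s (hsc.mono fun w hw => (hVO hw).1)
    have hyV : y ∈ s '' V := ⟨p y, hv, hsy⟩
    have hsub₁ : s '' V ⊆ S₁ ∪ R₁ := by
      rintro _ ⟨w, hw, rfl⟩
      refine hc₁ ?_
      rw [mem_preimage, hps w (hVO hw).1]
      exact (hVO hw).2.1
    have hsub₂ : s '' V ⊆ S₂ ∪ R₂ := by
      rintro _ ⟨w, hw, rfl⟩
      refine hc₂ ?_
      rw [mem_preimage, hps w (hVO hw).1]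
      exact (hVO hw).2.2
    refine hm.2 ⟨s m, ?_, hps m hmO⟩
    have hsm := mem_image_of_mem s hmV
    refine hy.imp (fun h => ?_) fun h => ?_
    · exact ⟨hsV.subset_left_of_subset_union hS₁ hR₁ hd₁ hsub₁ ⟨y, hyV, h.1⟩ hsm,
        hsV.subset_right_of_subset_union hS₂ hR₂ hd₂ hsub₂ ⟨y, hyV, h.2⟩ hsm⟩
    · exact ⟨hsV.subset_right_of_subset_union hS₁ hR₁ hd₁ hsub₁ ⟨y, hyV, h.1⟩ hsm,
        hsV.subset_left_of_subset_union hS₂ hR₂ hd₂ hsub₂ ⟨y, hyV, h.2⟩ hsm⟩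
  have hEB : U₁ ∩ U₂ ∩ B ⊆ E := by
    rintro m ⟨hm, hmB⟩
    refine ⟨hm, ?_⟩
    rintro ⟨y, hy | hy, rfl⟩
    · have : y ∈ p ⁻¹' B ∩ (W₁ ∩ W₂) := ⟨hmB, hSW₁ ⟨hy.1, hmB⟩, hRW₂ ⟨hy.2, hmB⟩⟩
      rw [hdis] at this
      exact this
    · have : y ∈ p ⁻¹' B ∩ (W₁ ∩ W₂) := ⟨hmB, hSW₂ ⟨hy.2, hmB⟩, hRW₁ ⟨hy.1, hmB⟩⟩
      rw [hdis] at this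
      exact this
  -- Outside `E` the two closed sets are disjoint. Shrinking each `Uᵢ` to `Oᵢ ∪ E` forces the new
  -- overlap into `E`, where the decompositions can be united.
  obtain ⟨O₁, O₂, hO₁, hO₂, hCO₁, hCO₂, hOO⟩ := SeparatedNhds.of_isCompact_isCompact
    (hC₁.sdiff hEo).isCompact (hC₂.sdiff hEo).isCompact (disjoint_left.2 fun m hm hm' =>
      hm.2 (hEB ⟨⟨hCU₁ hm.1, hCU₂ hm'.1⟩, hCB hm.1⟩))
  have hUE : ∀ m, m ∈ U₁ ∩ (O₁ ∪ E) → m ∈ U₂ ∩ (O₂ ∪ E) → m ∉ p '' D := by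
    rintro m ⟨-, h1 | h1⟩ ⟨-, h2 | h2⟩
    · exact (disjoint_left.1 hOO h1 h2).elim
    · exact h2.2
    · exact h1.2
    · exact h1.2
  have hUo₁ := hU₁.inter (hO₁.union hEo)
  have hUo₂ := hU₂.inter (hO₂.union hEo)
  refine ⟨U₁ ∩ (O₁ ∪ E) ∪ U₂ ∩ (O₂ ∪ E),
    S₁ ∩ p ⁻¹' (U₁ ∩ (O₁ ∪ E)) ∪ S₂ ∩ p ⁻¹' (U₂ ∩ (O₂ ∪ E)),
    R₁ ∩ p ⁻¹' (U₁ ∩ (O₁ ∪ E)) ∪ R₂ ∩ p ⁻¹' (U₂ ∩ (O₂ ∪ E)), hUo₁.union hUo₂,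
    (hS₁.inter (hUo₁.preimage hp.continuous)).union (hS₂.inter (hUo₂.preimage hp.continuous)),
    (hR₁.inter (hUo₁.preimage hp.continuous)).union (hR₂.inter (hUo₂.preimage hp.continuous)),
    ?_, ?_, ?_, ?_, ?_⟩
  · refine union_subset_union (fun m hm => ⟨hCU₁ hm, ?_⟩) fun m hm => ⟨hCU₂ hm, ?_⟩
    · exact (em (m ∈ E)).elim Or.inr fun h => Or.inl (hCO₁ ⟨hm, h⟩)
    · exact (em (m ∈ E)).elim Or.inr fun h => Or.inl (hCO₂ ⟨hm, h⟩)
  · rw [disjoint_left]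
    rintro y (⟨hS, hU⟩ | ⟨hS, hU⟩) (⟨hR, hU'⟩ | ⟨hR, hU'⟩)
    · exact disjoint_left.1 hd₁ hS hR
    · exact hUE _ hU hU' ⟨y, Or.inl ⟨hS, hR⟩, rfl⟩
    · exact hUE _ hU' hU ⟨y, Or.inr ⟨hR, hS⟩, rfl⟩
    · exact disjoint_left.1 hd₂ hS hR
  · rintro y (hy | hy)
    · exact (hc₁ hy.1).imp (fun h => Or.inl ⟨h, hy⟩) fun h => Or.inl ⟨h, hy⟩
    · exact (hc₂ hy.1).imp (fun h => Or.inr ⟨h, hy⟩) fun h => Or.inr ⟨h, hy⟩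
  · rintro y ⟨hy | hy, hyB⟩
    · exact hSW₁ ⟨hy.1, hyB⟩
    · exact hSW₂ ⟨hy.1, hyB⟩
  · rintro y ⟨hy | hy, hyB⟩
    · exact hRW₁ ⟨hy.1, hyB⟩
    · exact hRW₂ ⟨hy.1, hyB⟩

theorem separates_boundary [T2Space M] [CompactSpace M] (hp : IsCoveringMap p)
    (hM : IsThreeManifoldWithBoundary M B) (hW₁ : IsOpen W₁) (hW₂ : IsOpen W₂)
    (hW : p ⁻¹' B ⊆ W₁ ∪ W₂) (hdis : p ⁻¹' B ∩ (W₁ ∩ W₂) = ∅) : Separates p B W₁ W₂ B := by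
  have hB := hM.isClosed_boundary
  -- Compact induction runs over arbitrary subsets, while `Separates.union` needs closed sets with
  -- one inside `B`; hence `closure C ∩ B`.
  have h : Separates p B W₁ W₂ (closure B ∩ B) := by
    refine hB.isCompact.induction_on (p := fun C => Separates p B W₁ W₂ (closure C ∩ B)) ?_ ?_ ?_ ?_
    · exact ⟨∅, ∅, ∅, by simp⟩
    · exact fun C C' hC h => h.mono (inter_subset_inter_left _ (closure_mono hC))
    · intro C C' h h'
      rw [closure_union, union_inter_distrib_right]
      exact h.union hp hM hdis (isClosed_closure.inter hB) (isClosed_closure.inter hB)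
        inter_subset_right h'
    · intro m hm
      obtain ⟨V, hV, hsep⟩ := separates_nhd hp hM hW₁ hW₂ hW hdis hm
      obtain ⟨C, hC, hCc, hCV⟩ := exists_mem_nhds_isClosed_subset hV
      exact ⟨C, mem_nhdsWithin_of_mem_nhds hC,
        hsep.mono (inter_subset_left.trans (hCc.closure_eq.subset.trans hCV))⟩
  exact h.mono fun m hm => ⟨subset_closure hm, hm⟩

/-- Distinct components of `p⁻¹(B)` stay apart in `p⁻¹(U)` for some neighbourhood `U` of `B`. -/
theorem exists_nhd_connectedComponentIn_ne [T2Space M] [CompactSpace M] (hp : IsCoveringMap p)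
    (hM : IsThreeManifoldWithBoundary M B) {b b' : p ⁻¹' B}
    (h : ConnectedComponents.mk b' ≠ ConnectedComponents.mk b) :
    ∃ U, IsOpen U ∧ B ⊆ U ∧ b'.1 ∉ connectedComponentIn (p ⁻¹' U) b.1 := by
  have := (hM.preimage hp.isLocalHomeomorph).locallyConnectedSpace_boundary
  have hc : IsClopen (connectedComponent b) := isClopen_connectedComponent
  obtain ⟨W₁, hW₁, e₁⟩ := isOpen_induced_iff.1 hc.isOpen
  obtain ⟨W₂, hW₂, e₂⟩ := isOpen_induced_iff.1 hc.compl.isOpen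
  have h1 : ∀ c : p ⁻¹' B, c.1 ∈ W₁ ↔ c ∈ connectedComponent b := fun c => by rw [← e₁]; rfl
  have h2 : ∀ c : p ⁻¹' B, c.1 ∈ W₂ ↔ c ∉ connectedComponent b := fun c => by
    rw [← mem_compl_iff, ← e₂]; rfl
  have hdis : p ⁻¹' B ∩ (W₁ ∩ W₂) = ∅ := eq_empty_of_forall_notMem fun y hy =>
    (h2 ⟨y, hy.1⟩).1 hy.2.2 ((h1 ⟨y, hy.1⟩).1 hy.2.1)
  obtain ⟨U, S, R, hU, hS, hR, hBU, hd, hc, hSW, hRW⟩ := separates_boundary hp hM hW₁ hW₂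
    (fun y hy => (em (⟨y, hy⟩ ∈ connectedComponent b)).imp (h1 ⟨y, hy⟩).2 (h2 ⟨y, hy⟩).2) hdis
  refine ⟨U, hU, hBU, fun hmem => ?_⟩
  have hb : b.1 ∈ S := (hc (hBU b.2)).resolve_right fun hb =>
    (h2 b).1 (hRW ⟨hb, b.2⟩) mem_connectedComponent
  have hsub := isPreconnected_connectedComponentIn.subset_left_of_subset_union hS hR hd
    ((connectedComponentIn_subset _ _).trans hc) ⟨b.1, mem_connectedComponentIn (hBU b.2), hb⟩
  have := (h1 b').1 (hSW ⟨hsub hmem, b'.2⟩)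
  exact h (ConnectedComponents.coe_eq_coe'.2 this)

end Separation

/-! ### Ideal vertices and boundary components: uniqueness and equivariance -/

namespace LiftedTet

variable {T M M' : Type*} [TopologicalSpace M] [TopologicalSpace M'] {B : Set M}
  {K : IdealTriangulation T B} {p : M' → M}

/-- Points near the vertex would lie in the components of `p ⁻¹' U` around both `c` and `c'` for
every `U`, against the separation of distinct boundary components. -/
theorem VertexAt.unique [T2Space M] [CompactSpace M] (hp : IsCoveringMap p)
    (hM : IsThreeManifoldWithBoundary M B) {τ : LiftedTet K p} {i : Fin 4}
    {c c' : BoundaryComponents p B} (h : τ.VertexAt i c) (h' : τ.VertexAt i c') : c' = c := by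
  obtain ⟨b, rfl⟩ := ConnectedComponents.surjective_coe c
  obtain ⟨b', rfl⟩ := ConnectedComponents.surjective_coe c'
  by_contra hne
  obtain ⟨U, hU, hBU, hmem⟩ := exists_nhd_connectedComponentIn_ne hp hM hne
  obtain ⟨x, hx, hx'⟩ := ((h b rfl U hU hBU).and (h' b' rfl U hU hBU)).exists
  refine hmem ?_
  rw [connectedComponentIn_eq hx, ← connectedComponentIn_eq hx']
  exact mem_connectedComponentIn (hBU b'.2)

theorem VertexAt.translate {τ : LiftedTet K p} {i : Fin 4} {b : p ⁻¹' B}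
    (h : τ.VertexAt i (ConnectedComponents.mk b)) (f : Deck p) :
    (τ.translate f).VertexAt i (ConnectedComponents.mk (Deck.onBoundary B f b)) := by
  intro b' hb' U hU hBU
  have hc : Continuous (Deck.onBoundary B f⁻¹) :=
    (f⁻¹.1.continuous.comp continuous_subtype_val).subtype_mk _
  have hinv : ∀ c, Deck.onBoundary B f⁻¹ (Deck.onBoundary B f c) = c := fun c =>
    Subtype.ext (f.1.symm_apply_apply c.1)
  have h1 : ConnectedComponents.mk (Deck.onBoundary B f⁻¹ b') = ConnectedComponents.mk b := by
    have h2 := ConnectedComponents.coe_eq_coe'.1 hb'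
    have h3 := hc.image_connectedComponent_subset _ (mem_image_of_mem _ h2)
    rw [hinv] at h3
    exact ConnectedComponents.coe_eq_coe'.2 h3
  have hpre : f.1 '' (p ⁻¹' U) = p ⁻¹' U := by
    ext y
    constructor
    · rintro ⟨y, hy, rfl⟩
      rw [mem_preimage, f.2]
      exact hy
    · intro hy
      refine ⟨f.1.symm y, ?_, f.1.apply_symm_apply y⟩
      rw [mem_preimage, ← f.2, f.1.apply_symm_apply]
      exact hy
  filter_upwards [h _ h1 U hU hBU] with x hx
  have h4 := mem_image_of_mem f.1 hx
  rw [f.1.image_connectedComponentIn (hBU (Deck.onBoundary B f⁻¹ b').2), hpre] at h4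
  have h5 : f.1 (Deck.onBoundary B f⁻¹ b').1 = b'.1 := f.1.apply_symm_apply b'.1
  rwa [h5] at h4

end LiftedTet

namespace LiftedTet

section Vertices

variable {T M M' : Type*} [TopologicalSpace M] [TopologicalSpace M'] {B : Set M}
  {K : IdealTriangulation T B} {p : M' → M}
  [T2Space M] [CompactSpace M] [ConnectedSpace M] [Nonempty M'] [Finite T]

theorem exists_vertexAt (hp : IsCoveringMap p) (hM : IsThreeManifoldWithBoundary M B)
    (τ : LiftedTet K p) (i : Fin 4) : ∃ c, τ.VertexAt i c := by
  obtain ⟨b, hb⟩ := exists_boundary_mem_cuspRegion hp hM (τ.cusp i)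
  exact ⟨_, (vertexAt_iff hp hM).2 hb⟩

theorem exists_vertexAt_component (hp : IsCoveringMap p) (hM : IsThreeManifoldWithBoundary M B)
    (c : BoundaryComponents p B) : ∃ (τ : LiftedTet K p) (i : Fin 4), τ.VertexAt i c := by
  obtain ⟨b, rfl⟩ := ConnectedComponents.surjective_coe c
  obtain ⟨v, hv⟩ := exists_mem_cuspRegion (K := K) hp hM (boundary_subset_baseNhd _ b.2)
  induction v using Quot.ind with
  | mk a => exact ⟨a.1, a.2, (vertexAt_iff hp hM).2 hv⟩

theorem VertexAt.cusp_eq (hp : IsCoveringMap p) (hM : IsThreeManifoldWithBoundary M B)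
    {τ τ' : LiftedTet K p} {i j : Fin 4} {c : BoundaryComponents p B}
    (h : τ.VertexAt i c) (h' : τ'.VertexAt j c) : τ.cusp i = τ'.cusp j := by
  obtain ⟨b, rfl⟩ := ConnectedComponents.surjective_coe c
  exact eq_of_mem_cuspRegion hp (hM.preimage hp.isLocalHomeomorph).interior_boundary
    ((vertexAt_iff hp hM).1 h) ((vertexAt_iff hp hM).1 h')

theorem VertexAt.of_cusp_eq (hp : IsCoveringMap p) (hM : IsThreeManifoldWithBoundary M B)
    {τ τ' : LiftedTet K p} {i j : Fin 4} {c : BoundaryComponents p B}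
    (h : τ.VertexAt i c) (hc : τ'.cusp j = τ.cusp i) : τ'.VertexAt j c := by
  obtain ⟨b, rfl⟩ := ConnectedComponents.surjective_coe c
  rw [vertexAt_iff hp hM] at h ⊢
  rwa [hc]

end Vertices

/-! ### From compatible placements to shapes -/

section Placement

variable {T M M' : Type*} [TopologicalSpace M] [TopologicalSpace M'] {B : Set M}
  {K : IdealTriangulation T B} {p : M' → M} {Z : T → ℂ} {q : LiftedTet K p → Fin 4 → CP1}

/-- A placement of the vertices of all lifted tetrahedra, with shapes `Z`, that agrees on common
faces. -/
structure IsPlacement (Z : T → ℂ) (q : LiftedTet K p → Fin 4 → CP1) : Prop where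
  hasShape : ∀ τ, HasShape (q τ) (Z τ.tet)
  face : ∀ τ τ' i j, τ.IsNeighbour i τ' → j ≠ i → q τ' (K.perm τ.tet i j) = q τ j

/-- Walking around an edge. -/
theorem IsPlacement.exists_rot_iterate (hp : IsCoveringMap p) (hq : IsPlacement Z q)
    (τ : LiftedTet K p) (σ : Equiv.Perm (Fin 4)) (n : ℕ) :
    ∃ τ' : LiftedTet K p, ∃ σ' : Equiv.Perm (Fin 4), K.rot^[n] (τ.tet, σ) = (τ'.tet, σ') ∧
      q τ' (σ' 0) = q τ (σ 0) ∧ q τ' (σ' 1) = q τ (σ 1) ∧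
      (∀ x x' : PuncturedTet, x.1.1 (σ 2) = 0 → x.1.1 (σ 3) = 0 →
        (∀ j, x'.1.1 (σ' j) = x.1.1 (σ j)) → τ'.map x' = τ.map x) ∧
      ∏ k ∈ Finset.range n, edgeParam (Z (K.rot^[k] (τ.tet, σ)).1) (K.rot^[k] (τ.tet, σ)).2 =
        edgeCoord (q τ (σ 0)) (q τ (σ 1)) (q τ' (σ' 2)) /
          edgeCoord (q τ (σ 0)) (q τ (σ 1)) (q τ (σ 2)) := by
  have hne : ∀ (τ : LiftedTet K p) (σ : Equiv.Perm (Fin 4)) {i j : Fin 4}, i ≠ j →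
      q τ (σ i) ≠ q τ (σ j) := fun τ σ i j h => (hq.hasShape τ).1.ne (σ.injective.ne h)
  induction n with
  | zero =>
    refine ⟨τ, σ, rfl, rfl, rfl, fun x x' _ _ h => ?_, ?_⟩
    · congr 1
      refine PuncturedTet.ext fun i => ?_
      obtain ⟨j, rfl⟩ := σ.surjective i
      exact h j
    · rw [Finset.prod_range_zero, div_self]
      exact edgeCoord_ne_zero (hne τ σ (by decide)) (hne τ σ (by decide))
  | succ n ih =>
    obtain ⟨τ', σ', hrot, h0, h1, hx, hprod⟩ := ih
    obtain ⟨τ'', hn⟩ := exists_isNeighbour hp τ' (σ' 2)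
    have hface : ∀ j, j ≠ 2 → q τ'' (K.perm τ'.tet (σ' 2) (σ' j)) = q τ' (σ' j) := fun j hj =>
      hq.face _ _ _ _ hn (σ'.injective.ne hj)
    -- The transposition makes the exit face of one corner the entry face of the next: the old
    -- vertex `σ' 3` becomes the new vertex in place 2, so the product telescopes.
    refine ⟨τ'', K.perm τ'.tet (σ' 2) * σ' * Equiv.swap 2 3, ?_, ?_, ?_, ?_, ?_⟩
    · rw [Function.iterate_succ_apply', hrot, Triangulation.rot, hn.1]
    · exact (hface 0 (by decide)).trans h0
    · exact (hface 1 (by decide)).trans h1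
    · intro x x'' hx2 hx3 hxx
      set x' := x.reindex (σ' * σ⁻¹) with hx'
      have e : ∀ j, x'.1.1 (σ' j) = x.1.1 (σ j) := fun j => by
        have := PuncturedTet.reindex_apply (σ' * σ⁻¹) x (σ j)
        rw [Equiv.Perm.mul_apply] at this
        rw [← this]
        exact congrArg (fun k => x'.1.1 (σ' k)) (σ.symm_apply_apply j).symm
      rw [← hx x x' hx2 hx3 e]
      refine hn.2 x' x'' (by rw [e, hx2]) fun i => ?_
      obtain ⟨j, rfl⟩ := σ'.surjective i
      rw [e]
      have h3 := hxx (Equiv.swap 2 3 j)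
      rw [Equiv.Perm.mul_apply, Equiv.swap_apply_self, Equiv.Perm.mul_apply] at h3
      rw [h3]
      by_cases hj2 : j = 2
      · subst hj2
        rw [Equiv.swap_apply_left, hx2, hx3]
      · by_cases hj3 : j = 3
        · subst hj3
          rw [Equiv.swap_apply_right, hx2, hx3]
        · rw [Equiv.swap_apply_of_ne_of_ne hj2 hj3]
    · have h4 : q τ'' ((K.perm τ'.tet (σ' 2) * σ' * Equiv.swap 2 3 : Equiv.Perm (Fin 4)) 2) = q τ' (σ' 3) :=
        hface 3 (by decide)
      rw [Finset.prod_range_succ, hprod, hrot, (hq.hasShape τ').edgeParam_eq σ', h0, h1,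
        crossRatio_eq_edgeCoord_div, h4, div_mul_div_comm, mul_comm, mul_div_mul_right]
      rw [← h0, ← h1]
      exact edgeCoord_ne_zero (hne τ' σ' (by decide)) (hne τ' σ' (by decide))

theorem IsPlacement.isGluingSolution (hp : IsCoveringMap p) (hq : IsPlacement Z q)
    (hT : ∀ t, ∃ τ : LiftedTet K p, τ.tet = t) : K.IsGluingSolution Z := by
  refine ⟨fun t => ?_, fun a => ?_⟩
  · obtain ⟨τ, rfl⟩ := hT t
    exact ⟨(hq.hasShape τ).ne_zero, (hq.hasShape τ).ne_one⟩
  · obtain ⟨t, σ⟩ := a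
    obtain ⟨τ, rfl⟩ := hT t
    obtain ⟨τ', σ', hrot, -, -, hx, hprod⟩ :=
      hq.exists_rot_iterate hp τ σ (Function.minimalPeriod K.rot (τ.tet, σ))
    have hper : K.rot^[Function.minimalPeriod K.rot (τ.tet, σ)] (τ.tet, σ) = (τ.tet, σ) :=
      Function.isPeriodicPt_minimalPeriod _ _
    rw [hper] at hrot
    obtain ⟨ht, rfl⟩ := Prod.mk.inj hrot
    have h01 : σ 0 ≠ σ 1 := σ.injective.ne (by decide)
    -- After a full period the model tetrahedron and its ordering recur. The walk fixes the midpoint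
    -- of the edge, so the lift recurs too and the telescoped quotient is 1.
    have hττ : τ' = τ := eq_of_map_eq hp ht.symm
      (hx (PuncturedTet.edgePoint h01 (1 / 2) (by norm_num) (by norm_num)) _
        (PuncturedTet.edgePoint_other _ _ _ _ (σ.injective.ne (by decide))
          (σ.injective.ne (by decide)))
        (PuncturedTet.edgePoint_other _ _ _ _ (σ.injective.ne (by decide))
          (σ.injective.ne (by decide))) fun _ => rfl)
    rw [hprod, hττ, div_self]
    exact edgeCoord_ne_zero ((hq.hasShape τ).1.ne (σ.injective.ne (by decide)))
      ((hq.hasShape τ).1.ne (σ.injective.ne (by decide)))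

theorem IsPlacement.eq_of_develops (hq : IsPlacement Z q) {τ₀ τ : LiftedTet K p}
    {r : Fin 4 → CP1} (h : Develops Z τ₀ (q τ₀) τ r) : r = q τ := by
  induction h with
  | refl => rfl
  | @step τ τ' r r' i _ hn hr hs ih =>
    refine hs.eq_of_eq_off (hq.hasShape τ') (K.perm τ.tet i i) fun k hk => ?_
    obtain ⟨j, rfl⟩ := (K.perm τ.tet i).surjective k
    have hj : j ≠ i := fun hj => hk (congrArg _ hj)
    rw [hr j hj, ih, hq.face _ _ _ _ hn hj]

theorem IsPlacement.develops (hp : IsCoveringMap p) (hq : IsPlacement Z q) (hB : IsClosed B)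
    (hconn : IsPreconnected (p ⁻¹' B)ᶜ) (τ₀ τ : LiftedTet K p) :
    Develops Z τ₀ (q τ₀) τ (q τ) :=
  mem_of_isNeighbour_closed hp hB hconn (R := {τ | Develops Z τ₀ (q τ₀) τ (q τ)})
    (fun _ τ' i hn h => Develops.step i h hn (fun _ hj => hq.face _ _ _ _ hn hj) (hq.hasShape τ'))
    Develops.refl τ

theorem exists_translate_eq [SimplyConnectedSpace M'] [LocallyPathConnectedSpace M']
    (hp : IsCoveringMap p) {τ τ' : LiftedTet K p} (h : τ.tet = τ'.tet) :
    ∃ f : Deck p, τ' = τ.translate f := by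
  have x : PuncturedTet := Classical.arbitrary _
  obtain ⟨f, hf⟩ := hp.exists_deck (y := τ.map x) (y' := τ'.map x) (by rw [τ.lifts, τ'.lifts, h])
  exact ⟨f, eq_of_map_eq hp (x := x) h.symm hf.symm⟩

end Placement

/-! ### Developing -/

section Developing

variable {T M M' : Type*} [TopologicalSpace M] [TopologicalSpace M'] {B : Set M}
  {K : IdealTriangulation T B} {p : M' → M} {Z : T → ℂ} {τ₀ τ τ' : LiftedTet K p}
  {q₀ q q' : Fin 4 → CP1}

theorem Develops.hasShape (h₀ : HasShape q₀ (Z τ₀.tet)) (h : Develops Z τ₀ q₀ τ q) :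
    HasShape q (Z τ.tet) := by
  cases h with
  | refl => exact h₀
  | step _ _ _ _ h => exact h

theorem exists_develop_step {i : Fin 4} (hZ : ∀ t, Z t ≠ 0 ∧ Z t ≠ 1)
    (hq : Function.Injective q) :
    ∃ q', HasShape q' (Z τ'.tet) ∧ ∀ j, j ≠ i → q' (K.perm τ.tet i j) = q j := by
  obtain ⟨q', hq', h⟩ := exists_hasShape_of_eq_off (hZ τ'.tet).1 (hZ τ'.tet).2 (K.perm τ.tet i i)
    (q := q ∘ (K.perm τ.tet i).symm) fun a b _ _ hab =>
      (K.perm τ.tet i).symm.injective (hq hab)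
  refine ⟨q', hq', fun j hj => ?_⟩
  rw [h _ ((K.perm τ.tet i).injective.ne hj), Function.comp_apply, Equiv.symm_apply_apply]

/-- Trivial monodromy at `τ₀` propagates along a gallery: a rival placement of the last tetrahedron
is developed back across the last face, where the induction hypothesis applies, and rigidity brings
the agreement forward again. -/
theorem Develops.unique (hZ : ∀ t, Z t ≠ 0 ∧ Z t ≠ 1) (h₀ : HasShape q₀ (Z τ₀.tet))
    (hrefl : ∀ q, Develops Z τ₀ q₀ τ₀ q → q = q₀) (h : Develops Z τ₀ q₀ τ q) :
    ∀ q', Develops Z τ₀ q₀ τ q' → q' = q := by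
  induction h with
  | refl => exact hrefl
  | @step τ τ' r r' i hd hn hr hs ih =>
    intro q' hq'
    have hq's := hq'.hasShape h₀
    obtain ⟨s, hs', hsf⟩ := exists_develop_step (K := K) (τ := τ') (τ' := τ)
      (i := K.perm τ.tet i i) hZ hq's.1
    have hsr := ih s (.step _ hq' hn.symm hsf hs')
    subst hsr
    refine hq's.eq_of_eq_off hs (K.perm τ.tet i i) fun k hk => ?_
    obtain ⟨j, rfl⟩ := (K.perm τ.tet i).surjective k
    have hj : j ≠ i := fun hj => hk (congrArg _ hj)
    rw [hr j hj, ← hsf _ hk, hn.perm_eq]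
    exact congrArg s ((K.perm τ.tet i).symm_apply_apply j)

theorem exists_develops (hp : IsCoveringMap p) (hB : IsClosed B)
    (hconn : IsPreconnected (p ⁻¹' B)ᶜ) (hZ : ∀ t, Z t ≠ 0 ∧ Z t ≠ 1)
    (h₀ : HasShape q₀ (Z τ₀.tet)) (τ : LiftedTet K p) : ∃ q, Develops Z τ₀ q₀ τ q :=
  mem_of_isNeighbour_closed hp hB hconn (R := {τ | ∃ q, Develops Z τ₀ q₀ τ q})
    (fun τ τ' i hn ⟨q, hq⟩ => by
      obtain ⟨q', hq's, hq'⟩ := exists_develop_step (K := K) (τ := τ) (τ' := τ') (i := i) hZ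
        (hq.hasShape h₀).1
      exact ⟨q', .step i hq hn hq' hq's⟩)
    ⟨q₀, .refl⟩ τ

/-- A gallery from `τ₀` to its translate, continued by the translated gallery, develops to the image
under `g`, since shapes are invariant. -/
theorem Develops.translate {f : Deck p} {g : PSL2C}
    (hf : Develops Z τ₀ q₀ (τ₀.translate f) fun i => g • q₀ i) (h : Develops Z τ₀ q₀ τ q) :
    Develops Z τ₀ q₀ (τ.translate f) fun i => g • q i := by
  induction h with
  | refl => exact hf
  | step i _ hn hr hs ih =>
    exact .step i ih (hn.translate f) (fun j hj => congrArg (g • ·) (hr j hj)) (hs.smul g)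

end Developing

end LiftedTet

/-! ### The two implications -/

section Main

open LiftedTet

variable {M M' T : Type*} [TopologicalSpace M] [T2Space M] [CompactSpace M] [ConnectedSpace M]
  {B : Set M} [TopologicalSpace M'] [SimplyConnectedSpace M'] {p : M' → M} [Finite T]

theorem exists_solution_of_isAnchoring (hM : IsThreeManifoldWithBoundary M B)
    (hp : IsCoveringMap p) (x₀ : M') (K : IdealTriangulation T B)
    {ρ : FundamentalGroup M (p x₀) →* PSL2C} {L : BoundaryComponents p B → CP1}
    (hL : IsAnchoring hp x₀ B ρ L) (hess : IsEssential K p L) :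
    ∃ Z : T → ℂ, K.IsGluingSolution Z ∧ IsHolonomy K hp x₀ Z ρ := by
  have hM' := hM.preimage hp.isLocalHomeomorph
  have := hM'.locallyPathConnectedSpace
  have hlift : ∀ t, ∃ τ : LiftedTet K p, τ.tet = t := fun t => by
    obtain ⟨y, hy⟩ := hp.surjective (K.charMap t (Classical.arbitrary _))
    obtain ⟨τ, hτ, -⟩ := exists_map_eq hp t _ hy
    exact ⟨τ, hτ⟩
  choose c hc using fun (τ : LiftedTet K p) (i : Fin 4) => exists_vertexAt hp hM τ i
  set q : LiftedTet K p → Fin 4 → CP1 := fun τ i => L (c τ i) with hqdef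
  have hinj : ∀ τ, Function.Injective (q τ) := fun τ i j h => by
    by_contra hij
    exact hess τ i j hij _ _ (hc τ i) (hc τ j) h
  have hequiv : ∀ (f : Deck p) (τ : LiftedTet K p) i,
      q (τ.translate f) i = ρ (deckToPi1 hp x₀ f) • q τ i := by
    intro f τ i
    obtain ⟨b, hb⟩ := ConnectedComponents.surjective_coe (c τ i)
    have h1 := hc τ i
    rw [← hb] at h1
    have h2 := VertexAt.unique hp hM (hc (τ.translate f) i) (h1.translate f)
    simp only [hqdef]
    rw [← h2, ← hb]
    exact hL f b
  choose s hs using hlift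
  set Z : T → ℂ := fun t => crossRatio (q (s t) 0) (q (s t) 1) (q (s t) 2) (q (s t) 3) with hZ
  have hq : IsPlacement Z q := by
    refine ⟨fun τ => ⟨hinj τ, ?_⟩, fun τ τ' i j hn hj => ?_⟩
    · obtain ⟨f, hf⟩ := exists_translate_eq hp (hs τ.tet)
      rw [hf, hequiv, hequiv, hequiv, hequiv, crossRatio_smul]
      change Z τ.tet = Z (s τ.tet).tet
      rw [hs]
    · exact congrArg L (VertexAt.unique hp hM ((hc τ j).of_cusp_eq hp hM (hn.cusp_eq hj))
        (hc τ' _))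
  refine ⟨Z, hq.isGluingSolution hp fun t => ⟨s t, hs t⟩, ?_⟩
  -- The interior of the cover is nonempty, which provides an initial lifted tetrahedron.
  obtain ⟨V, -, -, -, -, -, ⟨y, -, hy⟩, -⟩ := hM'.exists_preconnected_nhd x₀ univ_mem
  obtain ⟨τ₀, -⟩ := exists_map_eq_of_notMem (K := K) hp hy
  refine ⟨τ₀, q τ₀, hq.hasShape τ₀, fun f r => ?_⟩
  have h1 : (fun i => ρ (deckToPi1 hp x₀ f) • q τ₀ i) = q (τ₀.translate f) :=
    funext fun i => (hequiv f τ₀ i).symm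
  rw [h1]
  refine ⟨hq.eq_of_develops, ?_⟩
  rintro rfl
  exact hq.develops hp hM.isClosed_boundary hM'.isPreconnected_compl τ₀ _

theorem exists_isAnchoring_of_isHolonomy (hM : IsThreeManifoldWithBoundary M B)
    (hp : IsCoveringMap p) (x₀ : M') (K : IdealTriangulation T B) {Z : T → ℂ}
    (hZ : ∀ t, Z t ≠ 0 ∧ Z t ≠ 1) {ρ : FundamentalGroup M (p x₀) →* PSL2C}
    (hρ : IsHolonomy K hp x₀ Z ρ) :
    ∃ L : BoundaryComponents p B → CP1, IsAnchoring hp x₀ B ρ L ∧ IsEssential K p L := by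
  have hM' := hM.preimage hp.isLocalHomeomorph
  obtain ⟨τ₀, q₀, h₀, hdev⟩ := hρ
  -- The holonomy condition for the identity deck transformation is exactly the absence of
  -- monodromy.
  have hrefl : ∀ q, Develops Z τ₀ q₀ τ₀ q → q = q₀ := fun q hq => by
    have h := (hdev 1 q).1 hq
    simpa only [map_one, one_smul] using h
  choose d hd using fun τ : LiftedTet K p =>
    exists_develops hp hM.isClosed_boundary hM'.isPreconnected_compl hZ h₀ τ
  have huniq : ∀ τ q, Develops Z τ₀ q₀ τ q → q = d τ := fun τ => (hd τ).unique hZ h₀ hrefl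
  -- Developing one step further keeps the common face in place, so by uniqueness the positions
  -- descend to ideal vertices.
  have hface : ∀ a b, FlagStep K p a b → d a.1 a.2 = d b.1 b.2 := by
    rintro ⟨τ, i⟩ ⟨τ', i'⟩ ⟨k, hk, hn, rfl⟩
    obtain ⟨q', hq's, hq'⟩ := exists_develop_step (K := K) (τ := τ) (τ' := τ') (i := k) hZ
      ((hd τ).hasShape h₀).1
    have h := huniq τ' q' (.step k (hd τ) hn hq' hq's)
    change d τ i = d τ' (K.perm τ.tet k i)
    rw [← h, hq' i hk.symm]
  have hcusp : ∀ {τ τ' : LiftedTet K p} {i j : Fin 4}, τ.cusp i = τ'.cusp j → d τ i = d τ' j :=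
    fun h => congrArg (Quot.lift (fun a : LiftedTet K p × Fin 4 => d a.1 a.2) hface) h
  choose s j hs using fun c : BoundaryComponents p B =>
    exists_vertexAt_component (K := K) hp hM c
  have hL : ∀ {τ : LiftedTet K p} {i : Fin 4} {c : BoundaryComponents p B}, τ.VertexAt i c →
      d (s c) (j c) = d τ i := fun h => hcusp (VertexAt.cusp_eq hp hM (hs _) h)
  refine ⟨fun c => d (s c) (j c), fun f b => ?_, fun τ i k hik u v hu hv h => ?_⟩
  · dsimp only
    rw [hL ((hs (ConnectedComponents.mk b)).translate f)]
    have h1 := Develops.translate ((hdev f _).2 rfl) (hd (s (ConnectedComponents.mk b)))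
    exact (congrFun (huniq _ _ h1) _).symm
  · dsimp only at h
    rw [hL hu, hL hv] at h
    exact hik (((hd τ).hasShape h₀).1 h)

end Main

end

theorem lemma2p17 {M M' T : Type*}
    [TopologicalSpace M] [T2Space M] [CompactSpace M] [ConnectedSpace M]
    {B : Set M} (_hM : IsThreeManifoldWithBoundary M B)
    [TopologicalSpace M'] [SimplyConnectedSpace M'] {p : M' → M} (hp : IsCoveringMap p) (x₀ : M')
    [Finite T] (K : IdealTriangulation T B)
    (ρ : FundamentalGroup M (p x₀) →* PSL2C) :
    (∃ L : BoundaryComponents p B → CP1, IsAnchoring hp x₀ B ρ L ∧ IsEssential K p L) ↔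
      ∃ Z : T → ℂ, K.IsGluingSolution Z ∧
        ∃ ρ' : FundamentalGroup M (p x₀) →* PSL2C, IsHolonomy K hp x₀ Z ρ' ∧
          ∃ g : PSL2C, ∀ γ, ρ' γ = g * ρ γ * g⁻¹ := by
  constructor
  · rintro ⟨L, hL, hess⟩
    obtain ⟨Z, hZ, hρ⟩ := exists_solution_of_isAnchoring _hM hp x₀ K hL hess
    exact ⟨Z, hZ, ρ, hρ, 1, fun γ => by simp⟩
  · rintro ⟨Z, hZ, ρ', hρ', g, hg⟩
    obtain ⟨L, hL, hess⟩ := exists_isAnchoring_of_isHolonomy _hM hp x₀ K hZ.1 hρ'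
    -- `L` anchors `g * ρ * g⁻¹`, so its translate by `g⁻¹` anchors `ρ`.
    refine ⟨fun c => g⁻¹ • L c, fun f b => ?_, fun τ i j hij u v hu hv h =>
      hess τ i j hij u v hu hv (MulAction.injective _ h)⟩
    dsimp only
    rw [hL f b, hg, smul_smul, smul_smul]
    congr 1
    group
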